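/- **Setting.** Let $\mathcal L$ be a countable first-order signature. The formulae of approximate measure logic (AML) are built from the atomic $\mathcal L$-formulae (with equality) by $\neg,\wedge,\exists,\forall$ and the measure constructors $m_{\vec x}<q.\varphi$ and $m_{\vec x}\le q.\varphi$, which bind the non-empty tuple $\vec x$ of distinct variables, for rationals $q\ge 0$. An AML *quasistructure* is an $\mathcal L$-structure $M$ with, for each $n\ge1$, an algebra $\mathcal B_n$ of subsets of $M^n$, a finitely additive $\mu_n:\mathcal B_n\to[0,\infty]$, such that $A\times B\in\mathcal B_{m+n}$ and $\mu_{m+n}(A\times B)=\mu_m(A)\mu_n(B)$ for $A\in\mathcal B_m$, $B\in\mathcal B_n$, and a labelling $v_n:\mathcal B_n\to\{\oplus,\ominus,\odot\}$ with $v_n(X)=\odot$ if $\mu_n(X)\notin\mathbb Q$. The formula $m_{\vec x}<q.\varphi$ holds if $X=\{\vec x:\varphi\}$ has $\mu(X)<q$, or $\mu(X)=q$ and $v(X)=\ominus$; $m_{\vec x}\le q.\varphi$ holds if $\mu(X)<q$, or $\mu(X)=q$ and $v(X)\neq\oplus$. It is an AML *structure* if all sets of $n$-tuples definable by AML formulae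 with parameters lie in $\mathcal B_n$. "Definable" always refers to AML formulae. An AML structure $\mathfrak N$ on a first-order substructure $N$ of $M$ is an *elementary substructure* of $\mathfrak M$ if $B\cap N^n\in\mathcal B_n^{\mathfrak N}$ for all $B\in\mathcal B_n^{\mathfrak M}$, and every AML formula has the same truth value in $\mathfrak N$ and in $\mathfrak M$ at all tuples from $N$. An AML structure is *measured* if it is equipped, for each $n\ge1$, with a measure, again written $\mu$, on a $\sigma$-algebra of subsets of $M^n$ containing all sets definable with parameters, which agrees with $\mu_n$ on definable sets; such that the measure on $M^{m+n}$ extends the product of the measures on $M^m$ and $M^n$; and such that the Fubini property holds: for measurable $B\subseteq M^{m+n}$, almost all sections $B^x\subseteq M^n$ ($x\in M^m$) and $B_y\subseteq M^m$ ($y\in M^n$) are measurable, the functions $x\mapsto\mu(B^x)$ and $y\mapsto\mu(B_y)$ are a.e.-measurable, and $\mu(B)=\int\mu(B^x)\,d\mu(x)=\int\mu(B_y)\,d\mu(y)$. $\mathfrak M$ is *$\aleph_1$-saturated* if every finitely satisfiable set of formulae in finitely many free variables with parameters from a countable subset of $M$ is realized in $\mathfrak M$. For $A\subseteq M$, $\operatorname{tp}(\vec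 a/A)$ is the set of formulae with parameters from $A$ satisfied by $\vec a$; a set of formulae is *wide* if each of them defines a set of positive measure. $\mathcal B_2(A)$ is the $\sigma$-algebra on $M^2$ generated by the $A$-definable sets, and $\mathcal B_{2,1}(A)$ the $\sigma$-algebra on $M^2$ generated by the sets $X\times M$ and $M\times X$ with $X\subseteq M$ definable over $A$. Let $\mathfrak N$ be an elementary substructure of $\mathfrak M$ with universe $N$. A set $S\subseteq M^2$ is *stable over $\mathfrak N$* if for every infinite sequence $(a_i,b_i)_{i\in\mathbb N}$ of pairs that is indiscernible over $N$, with $(a_i,b_j)\in S$ for all $i<j$, one also has $(a_j,b_i)\in S$ for some $i<j$. It is *wide-stable over $\mathfrak N$* if it is $N$-invariant (membership of $(a,b)$ in $S$ depends only on $\operatorname{tp}(a,b/N)$) and whenever $\operatorname{tp}(a/N)=\operatorname{tp}(a'/N)$, $\operatorname{tp}(b/N)=\operatorname{tp}(b'/N)$, both $\operatorname{tp}(a/N\cup\{b\})$ and $\operatorname{tp}(a'/N\cup\{b'\})$ are wide, and $(a,b)\in S$, then $(a',b')\in S$. **Theorem.** Let $\mathfrak M$ be an $\aleph_1$-saturated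 measured structure in a countable signature with $\mu(M)<\infty$, let $\mathfrak N$ be an elementary substructure of $\mathfrak M$ with countable universe $N$, and let $R\subseteq M^2$ belong to $\mathcal B_2(N)$. The following are equivalent: 1. there is $U\in\mathcal B_{2,1}(N)$ with $\mu(R\triangle U)=0$; 2. (ADS) for every $\epsilon>0$ there is a set $S\subseteq M^2$, definable over $N$ and stable over $\mathfrak N$, with $\mu(R\triangle S)<\epsilon$; 3. (ADWS) for every $\epsilon>0$ there is a set $S\subseteq M^2$, definable over $N$ and wide-stable over $\mathfrak N$, with $\mu(R\triangle S)<\epsilon$. -/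

import Mathlib

open MeasureTheory
open scoped ENNReal NNReal

universe u v w

namespace AML


/-- The two comparison symbols of the measure constructors `m < q` and `m ≤ q`. -/
inductive Cmp
  | lt
  | le

/-- Formulae of approximate measure logic with free variables among `x_0, …, x_{n-1}`. The
quantifiers bind the last variable `x_n`; `meas k c q φ` is the measure constructor: it binds the
sequence `x_n, …, x_{n+k}` of `k + 1` distinct variables, and `q` is a nonnegative rational. -/
inductive Formula (L : FirstOrder.Language.{u, v}) : ℕ → Type (max u v)
  | equal {n : ℕ} (t₁ t₂ : L.Term (Fin n)) : Formula L n
  | rel {n k : ℕ} (R : L.Relations k) (ts : Fin k → L.Term (Fin n)) : Formula L n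
  | neg {n : ℕ} (φ : Formula L n) : Formula L n
  | and {n : ℕ} (φ ψ : Formula L n) : Formula L n
  | ex {n : ℕ} (φ : Formula L (n + 1)) : Formula L n
  | all {n : ℕ} (φ : Formula L (n + 1)) : Formula L n
  | meas {n : ℕ} (k : ℕ) (c : Cmp) (q : ℚ≥0) (φ : Formula L (n + (k + 1))) : Formula L n

/-- The three labels of a measurable set: its measure is approximated from above (`⊕`), is
approximated from below (`⊖`), or is identified exactly (`⊙`). -/
inductive Label
  | plus
  | minus
  | dot

/-- A nonnegative rational as an extended nonnegative real. -/
noncomputable def ratCast (q : ℚ≥0) : ℝ≥0∞ := ((q : ℝ≥0) : ℝ≥0∞)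

/-- The product `A × B ⊆ M ^ (m + n)` of `A ⊆ M ^ m` and `B ⊆ M ^ n`. -/
def prodSet {M : Type w} {m n : ℕ} (A : Set (Fin m → M)) (B : Set (Fin n → M)) :
    Set (Fin (m + n) → M) :=
  {x | (fun i => x (Fin.castAdd n i)) ∈ A ∧ (fun j => x (Fin.natAdd m j)) ∈ B}

/-- AML quasistructures on a first-order structure `M`: for each `n ≥ 1` an algebra `Alg n` of
subsets of `M ^ n`, a finitely additive `[0, ∞]`-valued measure `μ n` on it, compatible with
products, and a labelling `v n`. The values of `μ n` and `v n` outside `Alg n` (and everything at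
`n = 0`) carry no information. -/
structure QuasiStructure (L : FirstOrder.Language.{u, v}) (M : Type w) [L.Structure M] where
  Alg : (n : ℕ) → Set (Set (Fin n → M))
  μ : (n : ℕ) → Set (Fin n → M) → ℝ≥0∞
  v : (n : ℕ) → Set (Fin n → M) → Label
  univ_mem : ∀ n, 0 < n → Set.univ ∈ Alg n
  compl_mem : ∀ n, 0 < n → ∀ X ∈ Alg n, Xᶜ ∈ Alg n
  union_mem : ∀ n, 0 < n → ∀ X ∈ Alg n, ∀ Y ∈ Alg n, X ∪ Y ∈ Alg n
  μ_empty : ∀ n, 0 < n → μ n ∅ = 0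
  μ_union : ∀ n, 0 < n → ∀ X ∈ Alg n, ∀ Y ∈ Alg n, Disjoint X Y → μ n (X ∪ Y) = μ n X + μ n Y
  prod_mem : ∀ m n, 0 < m → 0 < n → ∀ X ∈ Alg m, ∀ Y ∈ Alg n, prodSet X Y ∈ Alg (m + n)
  μ_prod : ∀ m n, 0 < m → 0 < n → ∀ X ∈ Alg m, ∀ Y ∈ Alg n,
    μ (m + n) (prodSet X Y) = μ m X * μ n Y
  v_eq_dot : ∀ n, 0 < n → ∀ X ∈ Alg n, (∀ q : ℚ≥0, μ n X ≠ ratCast q) → v n X = Label.dot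

section Semantics

variable {L : FirstOrder.Language.{u, v}} {M : Type w} [L.Structure M]

/-- The truth of `m ⋈ q. X` for a set `X` of `n`-tuples. -/
def QuasiStructure.MeasHolds (𝔐 : QuasiStructure L M) (c : Cmp) (q : ℚ≥0) (n : ℕ)
    (X : Set (Fin n → M)) : Prop :=
  match c with
  | Cmp.lt => 𝔐.μ n X < ratCast q ∨ (𝔐.μ n X = ratCast q ∧ 𝔐.v n X = Label.minus)
  | Cmp.le => 𝔐.μ n X < ratCast q ∨ (𝔐.μ n X = ratCast q ∧ 𝔐.v n X ≠ Label.plus)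

/-- Satisfaction. It is meaningful as soon as every set to which a measure constructor is applied
belongs to the algebra; this is so for all formulae in an AML structure, defined below. -/
def QuasiStructure.Realize (𝔐 : QuasiStructure L M) :
    {n : ℕ} → Formula L n → (Fin n → M) → Prop
  | _, .equal t₁ t₂, s => t₁.realize s = t₂.realize s
  | _, .rel R ts, s => FirstOrder.Language.Structure.RelMap R (fun i => (ts i).realize s)
  | _, .neg φ, s => ¬ 𝔐.Realize φ s
  | _, .and φ ψ, s => 𝔐.Realize φ s ∧ 𝔐.Realize ψ s
  | _, .ex φ, s => ∃ c : M, 𝔐.Realize φ (Fin.snoc s c)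
  | _, .all φ, s => ∀ c : M, 𝔐.Realize φ (Fin.snoc s c)
  | _, .meas k c q φ, s =>
      𝔐.MeasHolds c q (k + 1) {a : Fin (k + 1) → M | 𝔐.Realize φ (Fin.append s a)}

end Semantics

/-- AML structures: quasistructures in which every set of tuples that is defined by a formula with
parameters is measurable. -/
structure AMLStructure (L : FirstOrder.Language.{u, v}) (M : Type w) [L.Structure M]
    extends QuasiStructure L M where
  measurable : ∀ (m n : ℕ), 0 < n → ∀ (φ : Formula L (m + n)) (b : Fin m → M),
    {a : Fin n → M | toQuasiStructure.Realize φ (Fin.append b a)} ∈ Alg n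

/-- A formula in `n` free variables with parameters from `A`. -/
structure ParamFormula (L : FirstOrder.Language.{u, v}) {M : Type w} (A : Set M) (n : ℕ) where
  arity : ℕ
  formula : Formula L (arity + n)
  param : Fin arity → A

namespace AMLStructure

variable {L : FirstOrder.Language.{u, v}} {M : Type w} [L.Structure M]

/-- The subset of `M ^ n` defined by a formula with parameters. -/
def defSet (𝔐 : AMLStructure L M) {A : Set M} {n : ℕ} (φ : ParamFormula L A n) :
    Set (Fin n → M) :=
  {a | 𝔐.Realize φ.formula (Fin.append (fun i => (φ.param i : M)) a)}

/-- `D ⊆ M ^ n` is definable over `A`. -/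
def DefinableOver (𝔐 : AMLStructure L M) (A : Set M) {n : ℕ} (D : Set (Fin n → M)) : Prop :=
  ∃ φ : ParamFormula L A n, D = 𝔐.defSet φ

/-- The type `tp(a/A)`. -/
def tp (𝔐 : AMLStructure L M) {n : ℕ} (a : Fin n → M) (A : Set M) : Set (ParamFormula L A n) :=
  {φ | a ∈ 𝔐.defSet φ}

/-- A partial type over `A`: a finitely satisfiable set of formulae with parameters from `A`. -/
def IsPartialType (𝔐 : AMLStructure L M) {A : Set M} {n : ℕ} (p : Set (ParamFormula L A n)) :
    Prop :=
  ∀ F : Set (ParamFormula L A n), F.Finite → F ⊆ p → ∃ a : Fin n → M, ∀ φ ∈ F, a ∈ 𝔐.defSet φ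

/-- `ℵ₁`-saturation: partial types over countable sets are realized. -/
def Aleph1Saturated (𝔐 : AMLStructure L M) : Prop :=
  ∀ A : Set M, A.Countable → ∀ (n : ℕ) (p : Set (ParamFormula L A n)), 𝔐.IsPartialType p →
    ∃ a : Fin n → M, ∀ φ ∈ p, a ∈ 𝔐.defSet φ

/-- `𝔑`, an AML structure on the first-order substructure `N`, is an elementary substructure
of `𝔐`. -/
structure IsElementarySubstructure (𝔐 : AMLStructure L M) {N : L.Substructure M}
    (𝔑 : AMLStructure L N) : Prop where
  trace_mem : ∀ n, 0 < n → ∀ B ∈ 𝔐.Alg n, {x : Fin n → N | (fun i => (x i : M)) ∈ B} ∈ 𝔑.Alg n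
  realize_iff : ∀ (n : ℕ) (φ : Formula L n) (a : Fin n → N),
    𝔑.Realize φ a ↔ 𝔐.Realize φ (fun i => (a i : M))

/-- `𝓑_n(A)`: the `σ`-algebra on `M ^ n` generated by the sets that are definable over `A`. -/
@[reducible] def sigmaAlg (𝔐 : AMLStructure L M) (n : ℕ) (A : Set M) : MeasurableSpace (Fin n → M) :=
  MeasurableSpace.generateFrom {D | 𝔐.DefinableOver A D}

/-- `𝓑_{n,k}(A)`: the `σ`-algebra on `M ^ n` generated by the sets defined by formulae with
parameters from `A` all of whose free variables lie in `{x_i : i ∈ I}`, where `I` ranges over the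
sets of `k` indices. -/
@[reducible] def sigmaAlgSub (𝔐 : AMLStructure L M) (n k : ℕ) (A : Set M) : MeasurableSpace (Fin n → M) :=
  MeasurableSpace.generateFrom
    {D | ∃ (I : Finset (Fin n)) (hI : I.card = k) (φ : ParamFormula L A k),
      D = {x | (fun j => x (I.orderEmbOfFin hI j)) ∈ 𝔐.defSet φ}}

/-- The concatenation of a `k`-tuple of `r`-tuples. -/
def flatten {k r : ℕ} (t : Fin k → Fin r → M) : Fin (k * r) → M :=
  fun j => t (finProdFinEquiv.symm j).1 (finProdFinEquiv.symm j).2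

/-- Infinite sequences of `r`-tuples that are indiscernible over `A`. -/
def Indiscernible (𝔐 : AMLStructure L M) (A : Set M) {r : ℕ} (c : ℕ → Fin r → M) : Prop :=
  ∀ (k : ℕ) (φ : ParamFormula L A (k * r)) (i : Fin k → ℕ), StrictMono i →
    (flatten (fun j : Fin k => c j) ∈ 𝔐.defSet φ ↔ flatten (fun j => c (i j)) ∈ 𝔐.defSet φ)

/-- `R ⊆ M ^ (2m)` is stable over `A`. -/
def Stable (𝔐 : AMLStructure L M) (A : Set M) {m : ℕ} (R : Set (Fin (m + m) → M)) : Prop :=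
  ∀ a b : ℕ → Fin m → M, 𝔐.Indiscernible A (fun i => Fin.append (a i) (b i)) →
    (∀ i j, i < j → Fin.append (a i) (b j) ∈ R) → ∃ i j, i < j ∧ Fin.append (a j) (b i) ∈ R

/-- `R ⊆ M ^ n` is `A`-invariant: membership depends only on the type over `A`. -/
def Invariant (𝔐 : AMLStructure L M) (A : Set M) {n : ℕ} (R : Set (Fin n → M)) : Prop :=
  ∀ c c' : Fin n → M, 𝔐.tp c A = 𝔐.tp c' A → (c ∈ R ↔ c' ∈ R)

end AMLStructure

/-- Measured structures: AML structures equipped, for each `n ≥ 1`, with a countably additive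
measure `ν n` on a `σ`-algebra `σ n` on `M ^ n` that extends the algebra of definable sets, such
that `ν n` agrees with `μ n` on definable sets, `ν (m + n)` extends the product measure of `ν m`
and `ν n`, and the Fubini property holds. -/
structure MeasuredStructure (L : FirstOrder.Language.{u, v}) (M : Type w) [L.Structure M]
    extends AMLStructure L M where
  σ : (n : ℕ) → MeasurableSpace (Fin n → M)
  ν : (n : ℕ) → @Measure (Fin n → M) (σ n)
  measurableSet_of_definable : ∀ n, 0 < n → ∀ D : Set (Fin n → M),
    toAMLStructure.DefinableOver Set.univ D → MeasurableSet[σ n] D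
  ν_eq_μ : ∀ n, 0 < n → ∀ D : Set (Fin n → M),
    toAMLStructure.DefinableOver Set.univ D → ν n D = μ n D
  measurableSet_prod : ∀ m n, 0 < m → 0 < n → ∀ X Y, MeasurableSet[σ m] X → MeasurableSet[σ n] Y →
    MeasurableSet[σ (m + n)] (prodSet X Y)
  ν_prod : ∀ m n, 0 < m → 0 < n → ∀ X Y, MeasurableSet[σ m] X → MeasurableSet[σ n] Y →
    ν (m + n) (prodSet X Y) = ν m X * ν n Y
  ae_measurableSet_left : ∀ m n, 0 < m → 0 < n → ∀ B, MeasurableSet[σ (m + n)] B →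
    ∀ᵐ x ∂(ν m), MeasurableSet[σ n] {y | Fin.append x y ∈ B}
  ae_measurableSet_right : ∀ m n, 0 < m → 0 < n → ∀ B, MeasurableSet[σ (m + n)] B →
    ∀ᵐ y ∂(ν n), MeasurableSet[σ m] {x | Fin.append x y ∈ B}
  aemeasurable_left : ∀ m n, 0 < m → 0 < n → ∀ B, MeasurableSet[σ (m + n)] B →
    @AEMeasurable _ _ _ (σ m) (fun x => ν n {y | Fin.append x y ∈ B}) (ν m)
  aemeasurable_right : ∀ m n, 0 < m → 0 < n → ∀ B, MeasurableSet[σ (m + n)] B →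
    @AEMeasurable _ _ _ (σ n) (fun y => ν m {x | Fin.append x y ∈ B}) (ν n)
  fubini_left : ∀ m n, 0 < m → 0 < n → ∀ B, MeasurableSet[σ (m + n)] B →
    ν (m + n) B = ∫⁻ x, ν n {y | Fin.append x y ∈ B} ∂(ν m)
  fubini_right : ∀ m n, 0 < m → 0 < n → ∀ B, MeasurableSet[σ (m + n)] B →
    ν (m + n) B = ∫⁻ y, ν m {x | Fin.append x y ∈ B} ∂(ν n)

namespace MeasuredStructure

variable {L : FirstOrder.Language.{u, v}} {M : Type w} [L.Structure M]

/-- A partial type is wide if all its formulae define sets of positive measure. -/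
def Wide (𝔐 : MeasuredStructure L M) {A : Set M} {n : ℕ} (p : Set (ParamFormula L A n)) : Prop :=
  ∀ φ ∈ p, 0 < 𝔐.ν n (𝔐.defSet φ)

/-- `R ⊆ M ^ (2m)` is wide-stable over `A`. -/
def WideStable (𝔐 : MeasuredStructure L M) (A : Set M) {m : ℕ} (R : Set (Fin (m + m) → M)) :
    Prop :=
  𝔐.Invariant A R ∧
  ∀ a a' b b' : Fin m → M, 𝔐.tp a A = 𝔐.tp a' A → 𝔐.tp b A = 𝔐.tp b' A →
    𝔐.Wide (𝔐.tp a (A ∪ Set.range b)) → 𝔐.Wide (𝔐.tp a' (A ∪ Set.range b')) →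
    Fin.append a b ∈ R → Fin.append a' b' ∈ R

/-- `R ⊆ M ^ 2` is approximated by definable stable sets over `A`. -/
def ADS (𝔐 : MeasuredStructure L M) (A : Set M) (R : Set (Fin (1 + 1) → M)) : Prop :=
  ∀ ε : ℝ, 0 < ε → ∃ S : Set (Fin (1 + 1) → M),
    𝔐.Stable A S ∧ 𝔐.DefinableOver A S ∧ 𝔐.ν (1 + 1) (symmDiff R S) < ENNReal.ofReal ε

/-- `R ⊆ M ^ 2` is approximated by definable wide-stable sets over `A`. -/
def ADWS (𝔐 : MeasuredStructure L M) (A : Set M) (R : Set (Fin (1 + 1) → M)) : Prop :=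
  ∀ ε : ℝ, 0 < ε → ∃ S : Set (Fin (1 + 1) → M),
    𝔐.WideStable A S ∧ 𝔐.DefinableOver A S ∧ 𝔐.ν (1 + 1) (symmDiff R S) < ENNReal.ofReal ε

end MeasuredStructure

end AML

/-! 1 → 2. Up to small measure, a set in the σ-algebra generated by the unary definable sets is a
definable set that sees only the types over `N` of the two coordinates. Along an indiscernible
sequence all `a_i` have one type and all `b_i` have one type, so such a set is stable.

2 → 3 (`wideStable_of_stable`). Suppose a definable `S` separates two wide pairs `(a, b)`, `(a',
b')` whose coordinates have equal types. Take an ultrafilter `𝒰` that extends `tp(b/N)` and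
concentrates on `N`. Whether `𝒰` contains the fibre of `S` over `a` depends only on `tp(a/N)`, so
one of the two pairs, say `(a, b)`, disagrees with `𝒰`. Along a Morley sequence `(b_n)` of `𝒰`, the
sets that a formula of the wide type cuts out over the `b_n` have the same positive measure; as the
total measure is finite, any finitely many of them meet in positive measure (`ν_iInter_pos`).
Saturation then gives `a_n` of the type of `a` that relate to `b_0, …, b_n` as `a` does to `b`,
while every later `b_j` relates to `a_n` as `𝒰` prescribes. This half graph (`exists_halfGraph`),
made indiscernible and put in the right order (`exists_indiscernible_reversed`), contradicts
stability.

3 → 1. By Fubini, the points of a definable set that lie on null sections form a null set. There are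
countably many definable sets over `N`, so outside a union of definable sets of small total measure
all pairs have wide type. There wide-stability makes `S` a function of the types of the coordinates,
and compactness reduces these to finitely many unary definable sets (`exists_types_separated`). A
Borel–Cantelli limit passes from the approximations `S` to `R`. -/

namespace AML

/-! ### Renaming of variables, and countability of the set of formulae -/

section Relabel

variable {L : FirstOrder.Language.{u, v}}

/-- The extension of a map of variables to `k` further variables, which it keeps fixed. -/
def liftVar {n m : ℕ} (f : Fin n → Fin m) (k : ℕ) : Fin (n + k) → Fin (m + k) :=
  Fin.append (fun i => Fin.castAdd k (f i)) (Fin.natAdd m)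

theorem append_comp_liftVar {M : Type w} {n m k : ℕ} (f : Fin n → Fin m) (s : Fin m → M)
    (a : Fin k → M) : Fin.append s a ∘ liftVar f k = Fin.append (s ∘ f) a := by
  funext i
  refine Fin.addCases (fun i => ?_) (fun i => ?_) i <;> simp [liftVar]

/-- Renaming of the free variables of a formula. -/
def Formula.relabel : {n : ℕ} → Formula L n → {m : ℕ} → (Fin n → Fin m) → Formula L m
  | _, .equal t₁ t₂, _, f => .equal (t₁.relabel f) (t₂.relabel f)
  | _, .rel R ts, _, f => .rel R (fun i => (ts i).relabel f)
  | _, .neg φ, _, f => .neg (φ.relabel f)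
  | _, .and φ ψ, _, f => .and (φ.relabel f) (ψ.relabel f)
  | _, .ex φ, _, f => .ex (φ.relabel (liftVar f 1))
  | _, .all φ, _, f => .all (φ.relabel (liftVar f 1))
  | _, .meas k c q φ, _, f => .meas k c q (φ.relabel (liftVar f (k + 1)))

theorem snoc_comp_liftVar {M : Type w} {n m : ℕ} (f : Fin n → Fin m) (s : Fin m → M) (c : M) :
    (Fin.snoc s c : Fin (m + 1) → M) ∘ liftVar f 1 = (Fin.snoc (s ∘ f) c : Fin (n + 1) → M) := by
  rw [← Fin.append_right_eq_snoc s (fun _ => c), ← Fin.append_right_eq_snoc (s ∘ f) (fun _ => c),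
    append_comp_liftVar]

theorem QuasiStructure.realize_relabel {M : Type w} [L.Structure M] (𝔐 : QuasiStructure L M)
    {n : ℕ} (φ : Formula L n) {m : ℕ} (f : Fin n → Fin m) (s : Fin m → M) :
    𝔐.Realize (φ.relabel f) s ↔ 𝔐.Realize φ (s ∘ f) := by
  induction φ generalizing m with
  | equal t₁ t₂ => simp [Formula.relabel, Realize]
  | rel R ts => simp [Formula.relabel, Realize]
  | neg φ ih => simp [Formula.relabel, Realize, ih]
  | and φ ψ ih₁ ih₂ => simp [Formula.relabel, Realize, ih₁, ih₂]
  | ex φ ih => simp [Formula.relabel, Realize, ih, snoc_comp_liftVar]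
  | all φ ih => simp [Formula.relabel, Realize, ih, snoc_comp_liftVar]
  | meas k c q φ ih => simp [Formula.relabel, Realize, ih, append_comp_liftVar]

/-- The depth of a formula. -/
def Formula.depth : {n : ℕ} → Formula L n → ℕ
  | _, .equal _ _ => 0
  | _, .rel _ _ => 0
  | _, .neg φ => φ.depth + 1
  | _, .and φ ψ => max φ.depth ψ.depth + 1
  | _, .ex φ => φ.depth + 1
  | _, .all φ => φ.depth + 1
  | _, .meas _ _ _ φ => φ.depth + 1

theorem countable_sigma_relations [Countable L.Symbols] : Countable (Σ k, L.Relations k) :=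
  Function.Injective.countable (f := (Sum.inr : _ → L.Symbols)) Sum.inr_injective

theorem countable_term [Countable L.Symbols] (n : ℕ) : Countable (L.Term (Fin n)) := by
  have : Countable (Σ k, L.Functions k) :=
    Function.Injective.countable (f := (Sum.inl : _ → L.Symbols)) Sum.inl_injective
  exact FirstOrder.Language.Term.listEncode_injective.countable

/-- The binders change the number of free variables, so the induction on depth treats all `n` at
once. -/
theorem Formula.countable_setOf_depth_lt [Countable L.Symbols] (d : ℕ) :
    ∀ n, {φ : Formula L n | φ.depth < d}.Countable := by
  induction d with
  | zero => intro n; simp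
  | succ d ih =>
    intro n
    have := countable_term (L := L) n
    have := countable_sigma_relations (L := L)
    have (k : ℕ) : Countable (L.Relations k) :=
      Function.Injective.countable (f := fun R => (⟨k, R⟩ : Σ k, L.Relations k))
        sigma_mk_injective
    have h : {φ : Formula L n | φ.depth < d + 1} ⊆
        Set.range (fun t : L.Term (Fin n) × L.Term (Fin n) => Formula.equal t.1 t.2) ∪
        (⋃ k, Set.range (fun t : L.Relations k × (Fin k → L.Term (Fin n)) =>
          Formula.rel t.1 t.2)) ∪
        Formula.neg '' {φ | φ.depth < d} ∪
        Set.image2 Formula.and {φ | φ.depth < d} {φ | φ.depth < d} ∪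
        Formula.ex '' {φ | φ.depth < d} ∪ Formula.all '' {φ | φ.depth < d} ∪
        (⋃ (k : ℕ) (q : ℚ≥0), Formula.meas k Cmp.lt q '' {φ | φ.depth < d}) ∪
        (⋃ (k : ℕ) (q : ℚ≥0), Formula.meas k Cmp.le q '' {φ | φ.depth < d}) := by
      intro φ hφ
      simp only [Set.mem_union, Set.mem_range, Set.mem_iUnion, Set.mem_image, Set.mem_image2,
        Set.mem_ofPred_eq] at hφ ⊢
      cases φ with
      | equal t₁ t₂ => simp
      | rel R ts => simp
      | neg φ => simpa [Formula.depth] using hφ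
      | and φ ψ =>
        simp only [Formula.depth, add_lt_add_iff_right, max_lt_iff] at hφ
        simpa using hφ
      | ex φ => simpa [Formula.depth] using hφ
      | all φ => simpa [Formula.depth] using hφ
      | meas k c q φ =>
        simp only [Formula.depth, add_lt_add_iff_right] at hφ
        cases c
        · exact Or.inl (Or.inr ⟨k, q, φ, hφ, rfl⟩)
        · exact Or.inr ⟨k, q, φ, hφ, rfl⟩
    refine Set.Countable.mono h ?_
    refine (((((((Set.countable_range _).union (Set.countable_iUnion fun k =>
      Set.countable_range _)).union ((ih _).image _)).union ((ih _).image2 (ih _) _)).union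
      ((ih _).image _)).union ((ih _).image _)).union ?_).union ?_ <;>
    exact Set.countable_iUnion fun k => Set.countable_iUnion fun q => (ih _).image _

instance [Countable L.Symbols] (n : ℕ) : Countable (Formula L n) := by
  rw [← Set.countable_univ_iff]
  refine (Set.countable_iUnion fun d => Formula.countable_setOf_depth_lt (L := L) d n).mono ?_
  intro φ _
  exact Set.mem_iUnion.2 ⟨φ.depth + 1, Nat.lt_succ_self _⟩

theorem countable_paramFormula [Countable L.Symbols] {M : Type w} {A : Set M} (hA : A.Countable)
    (n : ℕ) : Countable (ParamFormula L A n) := by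
  have := hA.to_subtype
  refine Function.Injective.countable
    (f := fun φ : ParamFormula L A n =>
      (⟨φ.arity, φ.formula, φ.param⟩ : Σ m, Formula L (m + n) × (Fin m → A))) ?_
  rintro ⟨m, φ, p⟩ ⟨m', φ', p'⟩ h
  simp only [Sigma.mk.injEq] at h
  obtain ⟨rfl, h⟩ := h
  simp only [heq_eq_eq, Prod.mk.injEq] at h
  rw [h.1, h.2]

end Relabel

/-! ### Definable sets, types, and the dependence of measures on types -/

section Definability

variable {L : FirstOrder.Language.{u, v}} {M : Type w} [L.Structure M]

/-- `D ⊆ M ^ ι` is defined by a formula with parameters from `A`, in finitely many variables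
from `ι`. -/
def AMLStructure.FinDefinable (𝔐 : AMLStructure L M) (A : Set M) {ι : Type*} (D : Set (ι → M)) :
    Prop :=
  ∃ (m : ℕ) (φ : Formula L m) (g : Fin m → A ⊕ ι),
    D = {x | 𝔐.Realize φ (fun i => Sum.elim (fun a : A => (a : M)) x (g i))}

namespace AMLStructure

variable {𝔐 : AMLStructure L M} {A B : Set M} {ι κ : Type*}

theorem FinDefinable.univ : 𝔐.FinDefinable A (Set.univ : Set (ι → M)) :=
  -- There is no truth constant, and `ι` may be empty; `∀ x, x = x` needs no free variable.
  ⟨0, .all (.equal (.var 0) (.var 0)), Fin.elim0, by simp [QuasiStructure.Realize]⟩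

theorem FinDefinable.compl {D : Set (ι → M)} (h : 𝔐.FinDefinable A D) : 𝔐.FinDefinable A Dᶜ := by
  obtain ⟨m, φ, g, rfl⟩ := h
  exact ⟨m, .neg φ, g, rfl⟩

theorem FinDefinable.inter {D E : Set (ι → M)} (hD : 𝔐.FinDefinable A D)
    (hE : 𝔐.FinDefinable A E) : 𝔐.FinDefinable A (D ∩ E) := by
  obtain ⟨m, φ, g, rfl⟩ := hD
  obtain ⟨n, ψ, h, rfl⟩ := hE
  refine ⟨m + n, .and (φ.relabel (Fin.castAdd n)) (ψ.relabel (Fin.natAdd m)), Fin.append g h, ?_⟩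
  ext x
  simp [QuasiStructure.Realize, QuasiStructure.realize_relabel, Function.comp_def]

theorem FinDefinable.union {D E : Set (ι → M)} (hD : 𝔐.FinDefinable A D)
    (hE : 𝔐.FinDefinable A E) : 𝔐.FinDefinable A (D ∪ E) := by
  have := (hD.compl.inter hE.compl).compl
  rwa [Set.compl_inter, compl_compl, compl_compl] at this

theorem FinDefinable.biInter {α : Type*} {s : Set α} (hs : s.Finite) {D : α → Set (ι → M)}
    (h : ∀ i ∈ s, 𝔐.FinDefinable A (D i)) : 𝔐.FinDefinable A (⋂ i ∈ s, D i) := by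
  induction s, hs using Set.Finite.induction_on with
  | empty => simpa using FinDefinable.univ
  | insert _ _ ih =>
    rw [Set.biInter_insert]
    exact (h _ (Set.mem_insert _ _)).inter (ih fun i hi => h i (Set.mem_insert_of_mem _ hi))

theorem FinDefinable.iInter {α : Type*} [Finite α] {D : α → Set (ι → M)}
    (h : ∀ i, 𝔐.FinDefinable A (D i)) : 𝔐.FinDefinable A (⋂ i, D i) := by
  simpa using FinDefinable.biInter Set.finite_univ fun i _ => h i

theorem FinDefinable.iff {D E : Set (ι → M)} (hD : 𝔐.FinDefinable A D)
    (hE : 𝔐.FinDefinable A E) : 𝔐.FinDefinable A {x | x ∈ D ↔ x ∈ E} := by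
  have := (hD.inter hE).union (hD.compl.inter hE.compl)
  convert this using 1
  ext x
  simp only [Set.mem_ofPred_eq, Set.mem_union, Set.mem_inter_iff, Set.mem_compl_iff]
  tauto

theorem FinDefinable.preimage {D : Set (ι → M)} (h : 𝔐.FinDefinable A D) (f : ι → κ) :
    𝔐.FinDefinable A {x : κ → M | x ∘ f ∈ D} := by
  obtain ⟨m, φ, g, rfl⟩ := h
  refine ⟨m, φ, fun i => Sum.map id f (g i), ?_⟩
  ext x
  have : (fun i => Sum.elim (fun a : A => (a : M)) (x ∘ f) (g i)) =
      fun i => Sum.elim (fun a : A => (a : M)) x (Sum.map id f (g i)) := by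
    funext i
    cases g i <;> rfl
  simp [this]

theorem FinDefinable.mono {D : Set (ι → M)} (h : 𝔐.FinDefinable A D) (hAB : A ⊆ B) :
    𝔐.FinDefinable B D := by
  obtain ⟨m, φ, g, rfl⟩ := h
  refine ⟨m, φ, fun i => Sum.map (Set.inclusion hAB) id (g i), ?_⟩
  ext x
  have : (fun i => Sum.elim (fun a : B => (a : M)) x (Sum.map (Set.inclusion hAB) id (g i))) =
      fun i => Sum.elim (fun a : A => (a : M)) x (g i) := by
    funext i
    cases g i <;> rfl
  simp [this]

theorem FinDefinable.exists_fiber {b : κ → M} {D : Set (ι → M)}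
    (h : 𝔐.FinDefinable (A ∪ Set.range b) D) :
    ∃ E : Set (κ ⊕ ι → M), 𝔐.FinDefinable A E ∧ D = {x | Sum.elim b x ∈ E} := by
  classical
  obtain ⟨m, φ, g, rfl⟩ := h
  have hg : ∀ i, ∃ j : A ⊕ (κ ⊕ ι), ∀ x : ι → M,
      Sum.elim (fun a : A => (a : M)) (Sum.elim b x) j =
        Sum.elim (fun a : ↥(A ∪ Set.range b) => (a : M)) x (g i) := by
    intro i
    rcases g i with ⟨a, ha | ⟨k, hk⟩⟩ | j
    · exact ⟨.inl ⟨a, ha⟩, fun x => rfl⟩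
    · exact ⟨.inr (.inl k), fun x => hk⟩
    · exact ⟨.inr (.inr j), fun x => rfl⟩
  choose g' hg' using hg
  refine ⟨_, ⟨m, φ, g', rfl⟩, ?_⟩
  ext x
  simp [hg']

theorem FinDefinable.fiber {E : Set (κ ⊕ ι → M)} (h : 𝔐.FinDefinable A E) (b : κ → M) :
    𝔐.FinDefinable (A ∪ Set.range b) {x : ι → M | Sum.elim b x ∈ E} := by
  obtain ⟨m, φ, g, rfl⟩ := h
  refine ⟨m, φ, fun i => (g i).elim (fun a : A => .inl ⟨(a : M), .inl a.2⟩)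
    (Sum.elim (fun k => .inl ⟨b k, .inr ⟨k, rfl⟩⟩) .inr), ?_⟩
  ext x
  have : (fun i => Sum.elim (fun a : A => (a : M)) (Sum.elim b x) (g i)) =
      fun i => Sum.elim (fun a : ↥(A ∪ Set.range b) => (a : M)) x
        ((g i).elim (fun a : A => .inl ⟨(a : M), .inl a.2⟩)
          (Sum.elim (fun k => .inl ⟨b k, .inr ⟨k, rfl⟩⟩) .inr)) := by
    funext i
    rcases g i with a | k | j <;> rfl
  simp [this]

theorem definableOver_iff {n : ℕ} {D : Set (Fin n → M)} :
    𝔐.DefinableOver A D ↔ 𝔐.FinDefinable A D := by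
  classical
  constructor
  · rintro ⟨⟨p, φ, b⟩, rfl⟩
    refine ⟨p + n, φ, Fin.append (fun i => .inl (b i)) (fun j => .inr j), ?_⟩
    ext x
    have : (fun i => Sum.elim (fun a : A => (a : M)) x
        ((Fin.append (fun i => .inl (b i)) (fun j => .inr j) : Fin (p + n) → A ⊕ Fin n) i)) =
        Fin.append (fun i => (b i : M)) x := by
      funext i
      refine Fin.addCases (fun i => ?_) (fun i => ?_) i <;> simp
    simp [this, defSet]
  · rintro ⟨m, φ, g, rfl⟩
    -- The positions that carry parameters; renaming moves them in front of the `n` variables.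
    let P := {i : Fin m // (g i).isLeft}
    let e : P ≃ Fin (Fintype.card P) := Fintype.equivFin P
    let f : Fin m → Fin (Fintype.card P + n) := fun i =>
      if h : (g i).isLeft then Fin.castAdd n (e ⟨i, h⟩)
      else Fin.natAdd _ ((g i).getRight (by simpa using h))
    refine ⟨⟨Fintype.card P, φ.relabel f, fun j => (g (e.symm j)).getLeft (e.symm j).2⟩, ?_⟩
    ext x
    have : Fin.append (fun j => (((g (e.symm j)).getLeft (e.symm j).2 : A) : M)) x ∘ f =
        fun i => Sum.elim (fun a : A => (a : M)) x (g i) := by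
      funext i
      by_cases h : (g i).isLeft
      · have h' : g i = .inl ((g i).getLeft h) := by simp
        simp only [Function.comp_apply, f, h, dif_pos, Fin.append_left, Equiv.symm_apply_apply]
        conv_rhs => rw [h']
        rfl
      · obtain ⟨j, hj⟩ : ∃ j, g i = .inr j := Sum.isRight_iff.1 (by simpa using h)
        simp [f, hj]
    simp [defSet, QuasiStructure.realize_relabel, this]

theorem FinDefinable.measHolds {n k : ℕ} {D : Set (Fin (n + (k + 1)) → M)}
    (h : 𝔐.FinDefinable A D) (c : Cmp) (q : ℚ≥0) :
    𝔐.FinDefinable A {s : Fin n → M | 𝔐.MeasHolds c q (k + 1) {a | Fin.append s a ∈ D}} := by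
  obtain ⟨⟨p, φ, b⟩, rfl⟩ := definableOver_iff.2 h
  rw [← definableOver_iff]
  refine ⟨⟨p, .meas k c q (φ.relabel (Fin.cast (Nat.add_assoc p n (k + 1)).symm)), b⟩, ?_⟩
  ext s
  have (a : Fin (k + 1) → M) : Fin.append (Fin.append (fun i => (b i : M)) s) a ∘
      Fin.cast (Nat.add_assoc p n (k + 1)).symm =
      Fin.append (fun i => (b i : M)) (Fin.append s a) := by
    rw [Fin.append_assoc]
    rfl
  simp [defSet, QuasiStructure.Realize, QuasiStructure.realize_relabel, this]

/-- Two tuples that belong to the same `A`-definable sets. -/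
def SameType (𝔐 : AMLStructure L M) (A : Set M) (a a' : ι → M) : Prop :=
  ∀ D : Set (ι → M), 𝔐.FinDefinable A D → (a ∈ D ↔ a' ∈ D)

theorem sameType_of_imp {a a' : ι → M}
    (h : ∀ D : Set (ι → M), 𝔐.FinDefinable A D → a ∈ D → a' ∈ D) : 𝔐.SameType A a a' :=
  fun D hD => ⟨h D hD, fun h' => by_contra fun h'' => h Dᶜ hD.compl h'' h'⟩

theorem SameType.symm {a a' : ι → M} (h : 𝔐.SameType A a a') : 𝔐.SameType A a' a :=
  fun D hD => (h D hD).symm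

theorem SameType.comp {a a' : ι → M} (h : 𝔐.SameType A a a') (f : κ → ι) :
    𝔐.SameType A (a ∘ f) (a' ∘ f) :=
  fun _ hD => h _ (hD.preimage f)

theorem tp_eq_iff {n : ℕ} {a a' : Fin n → M} : 𝔐.tp a A = 𝔐.tp a' A ↔ 𝔐.SameType A a a' := by
  constructor
  · intro h D hD
    obtain ⟨φ, rfl⟩ := definableOver_iff.2 hD
    exact Set.ext_iff.1 h φ
  · intro h
    ext φ
    exact h _ (definableOver_iff.1 ⟨φ, rfl⟩)

theorem Aleph1Saturated.exists_forall_mem (hsat : 𝔐.Aleph1Saturated) (hA : A.Countable) {n : ℕ}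
    {𝒟 : Set (Set (Fin n → M))} (hne : 𝒟.Nonempty) (hdef : ∀ D ∈ 𝒟, 𝔐.FinDefinable A D)
    (hD : ∀ D ∈ 𝒟, D.Nonempty) (hinter : ∀ D ∈ 𝒟, ∀ E ∈ 𝒟, D ∩ E ∈ 𝒟) :
    ∃ a, ∀ D ∈ 𝒟, a ∈ D := by
  obtain ⟨a, ha⟩ := hsat A hA n {φ | 𝔐.defSet φ ∈ 𝒟} (by
    intro F hF hF𝒟
    obtain ⟨E, hE, hEF⟩ : ∃ E ∈ 𝒟, ∀ φ ∈ F, E ⊆ 𝔐.defSet φ := by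
      induction F, hF using Set.Finite.induction_on with
      | empty => exact ⟨hne.some, hne.some_mem, by simp⟩
      | @insert φ F _ _ ih =>
        obtain ⟨E, hE, hEF⟩ := ih ((Set.subset_insert _ _).trans hF𝒟)
        refine ⟨_, hinter E hE _ (hF𝒟 (Set.mem_insert φ F)), ?_⟩
        rintro ψ (rfl | hψ)
        · exact Set.inter_subset_right
        · exact Set.inter_subset_left.trans (hEF ψ hψ)
    obtain ⟨a, ha⟩ := hD E hE
    exact ⟨a, fun φ hφ => hEF φ hφ ha⟩)
  refine ⟨a, fun D hD => ?_⟩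
  obtain ⟨φ, rfl⟩ := definableOver_iff.2 (hdef D hD)
  exact ha φ hD

end AMLStructure

namespace MeasuredStructure

open AMLStructure

variable {𝔐 : MeasuredStructure L M} {A : Set M} {ι : Type*}

theorem measurableSet_of_finDefinable {n : ℕ} (hn : 0 < n) {D : Set (Fin n → M)}
    (h : 𝔐.FinDefinable A D) : MeasurableSet[𝔐.σ n] D :=
  𝔐.measurableSet_of_definable n hn D (definableOver_iff.2 (h.mono (Set.subset_univ A)))

theorem ν_eq_μ_of_finDefinable {n : ℕ} (hn : 0 < n) {D : Set (Fin n → M)}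
    (h : 𝔐.FinDefinable A D) : 𝔐.ν n D = 𝔐.μ n D :=
  𝔐.ν_eq_μ n hn D (definableOver_iff.2 (h.mono (Set.subset_univ A)))

theorem measHolds_of_lt {n : ℕ} (hn : 0 < n) {D : Set (Fin n → M)} (h : 𝔐.FinDefinable A D)
    {q : ℚ≥0} (hq : 𝔐.ν n D < ratCast q) : 𝔐.MeasHolds Cmp.le q n D :=
  Or.inl (by rwa [← ν_eq_μ_of_finDefinable hn h])

theorem ν_le_of_measHolds {n : ℕ} (hn : 0 < n) {D : Set (Fin n → M)} (h : 𝔐.FinDefinable A D)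
    {q : ℚ≥0} (hq : 𝔐.MeasHolds Cmp.le q n D) : 𝔐.ν n D ≤ ratCast q := by
  rw [ν_eq_μ_of_finDefinable hn h]
  rcases hq with hq | hq
  · exact hq.le
  · exact hq.1.le

theorem exists_ratCast_btwn {x y : ℝ≥0∞} (h : x < y) : ∃ q : ℚ≥0, x < ratCast q ∧ ratCast q < y := by
  obtain ⟨q, hq, h₁, h₂⟩ := ENNReal.lt_iff_exists_rat_btwn.1 h
  lift q to ℚ≥0 using hq
  have : (Real.toNNReal (q : ℚ) : ℝ≥0∞) = ratCast q := by
    change _ = ((q : ℝ≥0) : ℝ≥0∞)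
    rw [ENNReal.coe_inj]
    apply NNReal.eq
    rw [Real.coe_toNNReal _ (by exact_mod_cast q.2), Rat.cast_nnratCast]
    rfl
  rw [this] at h₁ h₂
  exact ⟨_, h₁, h₂⟩

/-- A rational strictly between two different measures would give a formula `m ≤ q` that
distinguishes `s` from `t`. Both inequalities are strict, so the labels play no role. -/
theorem ν_fiber_le {n k : ℕ} {D : Set (Fin (n + (k + 1)) → M)} (hD : 𝔐.FinDefinable A D)
    {s t : Fin n → M} (h : 𝔐.SameType A s t) :
    𝔐.ν (k + 1) {a | Fin.append s a ∈ D} ≤ 𝔐.ν (k + 1) {a | Fin.append t a ∈ D} := by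
  by_contra! hlt
  obtain ⟨q, h₁, h₂⟩ := exists_ratCast_btwn hlt
  have hfib (r : Fin n → M) : 𝔐.FinDefinable (A ∪ Set.range r) {a | Fin.append r a ∈ D} := by
    convert (hD.preimage (Fin.addCases Sum.inl Sum.inr)).fiber r using 1
    ext a
    have : Sum.elim r a ∘ (Fin.addCases Sum.inl Sum.inr : Fin (n + (k + 1)) → _) =
        Fin.append r a := by
      funext i
      refine Fin.addCases (fun i => ?_) (fun i => ?_) i <;> simp
    simp [this]
  refine h₂.not_ge (ν_le_of_measHolds k.succ_pos (hfib s) ?_)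
  exact (h _ (hD.measHolds Cmp.le q)).2 (measHolds_of_lt k.succ_pos (hfib t) h₁)

theorem ν_fiber_eq [Finite ι] {k : ℕ} {D : Set (ι ⊕ Fin (k + 1) → M)} (hD : 𝔐.FinDefinable A D)
    {s t : ι → M} (h : 𝔐.SameType A s t) :
    𝔐.ν (k + 1) {a | Sum.elim s a ∈ D} = 𝔐.ν (k + 1) {a | Sum.elim t a ∈ D} := by
  obtain ⟨n, ⟨e⟩⟩ := Finite.exists_equiv_fin ι
  have hD' := hD.preimage (Sum.elim (Fin.castAdd (k + 1) ∘ e) (Fin.natAdd n))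
  have key (r : ι → M) (a : Fin (k + 1) → M) : Fin.append (r ∘ e.symm) a ∘
      Sum.elim (Fin.castAdd (k + 1) ∘ e) (Fin.natAdd n) = Sum.elim r a := by
    funext i
    cases i <;> simp
  have h₁ := ν_fiber_le hD' (h.comp e.symm)
  have h₂ := ν_fiber_le hD' (h.symm.comp e.symm)
  simp only [Set.mem_ofPred_eq, key] at h₁ h₂
  exact le_antisymm h₁ h₂

end MeasuredStructure

end Definability

theorem exists_seq_of_forall_fin {X : Type*} (P : ∀ n : ℕ, (Fin n → X) → X → Prop)
    (H : ∀ n h, ∃ x, P n h x) : ∃ f : ℕ → X, ∀ n, P n (fun i => f i) (f n) := by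
  choose F hF using H
  let f : ℕ → X := WellFounded.fix Nat.lt_wfRel.wf fun n g => F n fun i => g i i.2
  refine ⟨f, fun n => ?_⟩
  have : f n = F n fun i => f i := WellFounded.fix_eq _ _ _
  rw [this]
  exact hF n _

/-! ### Morley sequences of ultrafilters, and coheirs -/

section Morley

variable {L : FirstOrder.Language.{u, v}} {M : Type w} [L.Structure M]

namespace AMLStructure

variable {𝔐 : AMLStructure L M} {A : Set M} {r : ℕ} {𝒰 : Ultrafilter (Fin r → M)}

/-- Each `c j` realizes the restriction of the global type `𝒰` to `A` and the earlier terms. -/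
def IsMorley (𝔐 : AMLStructure L M) (𝒰 : Ultrafilter (Fin r → M)) (A : Set M) {J : Type*} [LT J]
    (c : J → Fin r → M) : Prop :=
  ∀ j, ∀ D : Set (Fin r → M),
    𝔐.FinDefinable (A ∪ Set.range fun p : {i // i < j} × Fin r => c p.1 p.2) D → D ∈ 𝒰 → c j ∈ D

theorem IsMorley.comp {J J' : Type*} [LT J] [LT J'] {c : J → Fin r → M}
    (hc : 𝔐.IsMorley 𝒰 A c) {f : J' → J} (hf : ∀ i j, i < j → f i < f j) :
    𝔐.IsMorley 𝒰 A (c ∘ f) := by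
  intro j D hD hD𝒰
  refine hc (f j) D (hD.mono (Set.union_subset_union_right _ ?_)) hD𝒰
  rintro _ ⟨p, rfl⟩
  exact ⟨(⟨f p.1, hf _ _ p.1.2⟩, p.2), rfl⟩

theorem IsMorley.mem_iff {J : Type*} [LT J] {c : J → Fin r → M} (hc : 𝔐.IsMorley 𝒰 A c) (j : J)
    {D : Set (Fin r → M)}
    (hD : 𝔐.FinDefinable (A ∪ Set.range fun p : {i // i < j} × Fin r => c p.1 p.2) D) :
    c j ∈ D ↔ D ∈ 𝒰 := by
  refine ⟨fun h => ?_, hc j D hD⟩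
  by_contra h'
  exact hc j _ hD.compl (Ultrafilter.compl_mem_iff_notMem.2 h') h

/-- For `y` in `A` the condition on `s` is itself definable over `A`, so the two fibres have the
same points in `A`, and `𝒰` sees only those. -/
theorem fiber_mem_iff_of_sameType (hA : {x : Fin r → M | ∀ j, x j ∈ A} ∈ 𝒰) {κ : Type*}
    {E : Set (κ ⊕ Fin r → M)} (hE : 𝔐.FinDefinable A E) {s t : κ → M} (h : 𝔐.SameType A s t) :
    {y | Sum.elim s y ∈ E} ∈ 𝒰 ↔ {y | Sum.elim t y ∈ E} ∈ 𝒰 := by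
  have key : ∀ y : Fin r → M, (∀ j, y j ∈ A) → (Sum.elim s y ∈ E ↔ Sum.elim t y ∈ E) := by
    intro y hy
    have := (hE.preimage (Sum.swap (α := κ) (β := Fin r))).fiber y
    rw [Set.union_eq_self_of_subset_right (by rintro _ ⟨j, rfl⟩; exact hy j)] at this
    have hswap (s : κ → M) : Sum.elim y s ∘ Sum.swap = Sum.elim s y := by
      funext i
      cases i <;> rfl
    simpa only [Set.mem_ofPred_eq, hswap] using h _ this
  constructor <;> intro h' <;> filter_upwards [hA, h'] with y hy hy'
  · exact (key y hy).1 hy'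
  · exact (key y hy).2 hy'

/-- Induction on the length: `𝒰` decides the last term over the earlier ones, and its decision
depends only on their type over `A`. -/
theorem IsMorley.sameType (hA : {x : Fin r → M | ∀ j, x j ∈ A} ∈ 𝒰) :
    ∀ {k : ℕ} {c c' : Fin k → Fin r → M}, 𝔐.IsMorley 𝒰 A c → 𝔐.IsMorley 𝒰 A c' →
      𝔐.SameType A (fun p : Fin k × Fin r => c p.1 p.2) fun p => c' p.1 p.2 := by
  intro k
  induction k with
  | zero =>
    intro c c' _ _ D _
    rw [Subsingleton.elim (fun p : Fin 0 × Fin r => c p.1 p.2) fun p => c' p.1 p.2]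
  | succ k ih =>
    intro c c' hc hc' D hD
    let h : Fin (k + 1) × Fin r → (Fin k × Fin r) ⊕ Fin r :=
      fun p => Fin.lastCases (motive := fun _ => (Fin k × Fin r) ⊕ Fin r) (.inr p.2)
        (fun i => .inl (i, p.2)) p.1
    have hcomp (d : Fin (k + 1) → Fin r → M) : (fun p : Fin (k + 1) × Fin r => d p.1 p.2) =
        Sum.elim (fun p : Fin k × Fin r => d p.1.castSucc p.2) (d (Fin.last k)) ∘ h := by
      funext ⟨i, j⟩
      refine Fin.lastCases ?_ (fun i => ?_) i <;> simp [h]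
    have hmem {d : Fin (k + 1) → Fin r → M} (hd : 𝔐.IsMorley 𝒰 A d) :
        (fun p : Fin (k + 1) × Fin r => d p.1 p.2) ∈ D ↔
        {y | Sum.elim (fun p : Fin k × Fin r => d p.1.castSucc p.2) y ∈ {x | x ∘ h ∈ D}} ∈ 𝒰 := by
      rw [hcomp]
      refine hd.mem_iff (Fin.last k) (((hD.preimage h).fiber _).mono
        (Set.union_subset_union_right _ ?_))
      rintro _ ⟨p, rfl⟩
      exact ⟨(⟨p.1.castSucc, Fin.castSucc_lt_last _⟩, p.2), rfl⟩
    rw [hmem hc, hmem hc']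
    have hmono : ∀ i j : Fin k, i < j → i.castSucc < j.castSucc := fun _ _ h => h
    exact fiber_mem_iff_of_sameType hA (hD.preimage h) (ih (hc.comp hmono) (hc'.comp hmono))

theorem IsMorley.indiscernible (hA : {x : Fin r → M | ∀ j, x j ∈ A} ∈ 𝒰) {c : ℕ → Fin r → M}
    (hc : 𝔐.IsMorley 𝒰 A c) : 𝔐.Indiscernible A c := by
  intro k φ i hi
  have h := IsMorley.sameType hA (hc.comp (f := fun j : Fin k => (j : ℕ)) fun _ _ h => h)
    (hc.comp (f := i) fun _ _ h => hi h)
  exact (h.comp finProdFinEquiv.symm) _ (definableOver_iff.1 ⟨φ, rfl⟩)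

theorem Aleph1Saturated.exists_realization (hsat : 𝔐.Aleph1Saturated) (hA : A.Countable)
    (𝒰 : Ultrafilter (Fin r → M)) : ∃ x, ∀ D, 𝔐.FinDefinable A D → D ∈ 𝒰 → x ∈ D := by
  obtain ⟨x, hx⟩ := hsat.exists_forall_mem hA (𝒟 := {D | 𝔐.FinDefinable A D ∧ D ∈ 𝒰})
    ⟨_, FinDefinable.univ, Filter.univ_mem⟩ (fun D hD => hD.1)
    (fun D hD => Ultrafilter.nonempty_of_mem hD.2)
    (fun D hD E hE => ⟨hD.1.inter hE.1, Filter.inter_mem hD.2 hE.2⟩)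
  exact ⟨x, fun D hD hD𝒰 => hx D ⟨hD, hD𝒰⟩⟩

theorem isMorley_of_forall_fin {c : ℕ → Fin r → M}
    (h : ∀ n, ∀ D, 𝔐.FinDefinable (A ∪ Set.range fun p : Fin n × Fin r => c p.1 p.2) D →
      D ∈ 𝒰 → c n ∈ D) : 𝔐.IsMorley 𝒰 A c := by
  intro n D hD
  refine h n D (hD.mono (Set.union_subset_union_right _ ?_))
  rintro _ ⟨p, rfl⟩
  exact ⟨(⟨p.1, p.1.2⟩, p.2), rfl⟩

theorem Aleph1Saturated.exists_isMorley (hsat : 𝔐.Aleph1Saturated) (hA : A.Countable)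
    (𝒰 : Ultrafilter (Fin r → M)) : ∃ c : ℕ → Fin r → M, 𝔐.IsMorley 𝒰 A c := by
  obtain ⟨c, hc⟩ := exists_seq_of_forall_fin (X := Fin r → M)
    (fun n h x => ∀ D, 𝔐.FinDefinable (A ∪ Set.range fun p : Fin n × Fin r => h p.1 p.2) D →
      D ∈ 𝒰 → x ∈ D)
    (fun n h => hsat.exists_realization (hA.union (Set.countable_range _)) 𝒰)
  exact ⟨c, isMorley_of_forall_fin hc⟩

variable {N : L.Substructure M} {𝔑 : AMLStructure L N}

theorem IsElementarySubstructure.exists_mem (hN : 𝔐.IsElementarySubstructure 𝔑)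
    {D : Set (Fin 1 → M)} (hD : 𝔐.FinDefinable (N : Set M) D) (hne : D.Nonempty) :
    ∃ x ∈ D, ∀ j, x j ∈ N := by
  obtain ⟨⟨p, φ, b⟩, rfl⟩ := definableOver_iff.2 hD
  have key (x : Fin 1 → M) : Fin.append (fun i => (b i : M)) x =
      (Fin.snoc (fun i => (b i : M)) (x 0) : Fin (p + 1) → M) := Fin.append_right_eq_snoc _ _
  obtain ⟨x, hx⟩ := hne
  have h₁ : 𝔐.Realize (.ex φ) (fun i => (b i : M)) := by
    refine ⟨x 0, ?_⟩
    rw [← key]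
    exact hx
  obtain ⟨c, hc⟩ := (hN.realize_iff _ (.ex φ) b).2 h₁
  refine ⟨fun _ => c, ?_, fun _ => c.2⟩
  have h₂ := (hN.realize_iff _ φ _).1 hc
  change 𝔐.Realize φ (Fin.append _ _)
  rw [key]
  convert h₂ using 1
  funext i
  refine Fin.lastCases ?_ (fun i => ?_) i <;> simp

/-- By elementarity each set in `tp(b/N)` has a point in `N`, so these sets and the set of points of
`N` generate a proper filter. -/
theorem IsElementarySubstructure.exists_coheir (hN : 𝔐.IsElementarySubstructure 𝔑)
    (b : Fin 1 → M) : ∃ 𝒰 : Ultrafilter (Fin 1 → M), {x : Fin 1 → M | ∀ j, x j ∈ (N : Set M)} ∈ 𝒰 ∧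
      ∀ D, 𝔐.FinDefinable (N : Set M) D → b ∈ D → D ∈ 𝒰 := by
  let F : Filter (Fin 1 → M) :=
    { sets := {X | ∃ D, 𝔐.FinDefinable (N : Set M) D ∧ b ∈ D ∧
        D ∩ {x : Fin 1 → M | ∀ j, x j ∈ (N : Set M)} ⊆ X}
      univ_sets := ⟨_, FinDefinable.univ, trivial, Set.subset_univ _⟩
      sets_of_superset := fun ⟨D, h₁, h₂, h₃⟩ h => ⟨D, h₁, h₂, h₃.trans h⟩
      inter_sets := fun ⟨D, h₁, h₂, h₃⟩ ⟨E, g₁, g₂, g₃⟩ =>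
        ⟨D ∩ E, h₁.inter g₁, ⟨h₂, g₂⟩, fun x hx => ⟨h₃ ⟨hx.1.1, hx.2⟩, g₃ ⟨hx.1.2, hx.2⟩⟩⟩ }
  have : F.NeBot := by
    rw [← Filter.empty_mem_iff_bot.not.trans Filter.neBot_iff.symm]
    rintro ⟨D, hD, hb, h⟩
    obtain ⟨x, hx, hxN⟩ := hN.exists_mem hD ⟨b, hb⟩
    exact h ⟨hx, hxN⟩
  refine ⟨Ultrafilter.of F, Ultrafilter.of_le F ?_, fun D hD hb => Ultrafilter.of_le F ?_⟩
  · exact ⟨_, FinDefinable.univ, trivial, Set.inter_subset_right⟩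
  · exact ⟨D, hD, hb, Set.inter_subset_left⟩

end AMLStructure

end Morley

/-- The limsup of the `E i` has measure at least `δ`, and the countably many `k`-fold intersections
cover it, so they cannot all be null. -/
theorem exists_strictMono_measure_iInter_pos {α : Type*} {m : MeasurableSpace α} {μ : Measure α}
    [IsFiniteMeasure μ] {E : ℕ → Set α} (hE : ∀ i, MeasurableSet (E i)) {δ : ℝ≥0∞} (hδ : 0 < δ)
    (h : ∀ i, δ ≤ μ (E i)) (k : ℕ) :
    ∃ f : Fin k → ℕ, StrictMono f ∧ 0 < μ (⋂ i, E (f i)) := by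
  by_contra! hcon
  let T : ℕ → Set α := fun n => ⋃ i ≥ n, E i
  have hT : Antitone T := fun n n' hn =>
    Set.biUnion_subset_biUnion_left fun i (hi : n' ≤ i) => hn.trans hi
  have hle : δ ≤ μ (⋂ n, T n) := by
    refine ge_of_tendsto' (tendsto_measure_iInter_atTop (fun n => MeasurableSet.nullMeasurableSet
      (MeasurableSet.iUnion fun i => MeasurableSet.iUnion fun _ => hE i)) hT
      ⟨0, measure_ne_top μ _⟩) fun n => (h n).trans (measure_mono ?_)
    exact Set.subset_biUnion_of_mem (u := E) (Set.mem_Ici.2 le_rfl)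
  have hsub : ⋂ n, T n ⊆ ⋃ f : {f : Fin k → ℕ // StrictMono f}, ⋂ i, E (f.1 i) := by
    intro x hx
    have hinf : {i | x ∈ E i}.Infinite := by
      rw [Set.infinite_iff_exists_gt]
      intro n
      have := Set.mem_iInter.1 hx (n + 1)
      simp only [T, Set.mem_iUnion] at this
      obtain ⟨i, hi, hxi⟩ := this
      exact ⟨i, hxi, hi⟩
    refine Set.mem_iUnion.2 ⟨⟨fun i => Nat.nth (fun i => x ∈ E i) i, fun i j hij =>
      Nat.nth_strictMono hinf hij⟩, Set.mem_iInter.2 fun i => ?_⟩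
    exact Nat.nth_mem_of_infinite hinf _
  have hzero : μ (⋃ f : {f : Fin k → ℕ // StrictMono f}, ⋂ i, E (f.1 i)) = 0 :=
    measure_iUnion_null fun f => nonpos_iff_eq_zero.1 (hcon f.1 f.2)
  exact hδ.not_ge (hle.trans ((measure_mono hsub).trans hzero.le))

theorem append_eq_pair {M : Type w} (a b : Fin 1 → M) : Fin.append a b = ![a 0, b 0] := by
  funext i
  fin_cases i <;> rfl

theorem pair_eta {M : Type w} (x : Fin 2 → M) : ![x 0, x 1] = x := by
  funext i
  fin_cases i <;> rfl

/-! ### Definable stable sets are wide-stable -/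

section Stability

variable {L : FirstOrder.Language.{u, v}} {M : Type w} [L.Structure M]

namespace AMLStructure

variable {𝔐 : AMLStructure L M} {A B : Set M} {ι κ : Type*}

theorem FinDefinable.pair_left {P : Set (Fin 2 → M)} (hP : 𝔐.FinDefinable A P) (y : κ → M) (k : κ)
    (i : ι) : 𝔐.FinDefinable (A ∪ Set.range y) {x : ι → M | ![x i, y k] ∈ P} := by
  convert (hP.preimage ![(.inr i : κ ⊕ ι), .inl k]).fiber y using 1
  ext x
  have : Sum.elim y x ∘ ![(.inr i : κ ⊕ ι), .inl k] = ![x i, y k] := by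
    funext j
    fin_cases j <;> rfl
  simp [this]

theorem FinDefinable.pair_right {P : Set (Fin 2 → M)} (hP : 𝔐.FinDefinable A P) (y : κ → M) (k : κ)
    (i : ι) : 𝔐.FinDefinable (A ∪ Set.range y) {x : ι → M | ![y k, x i] ∈ P} := by
  convert (hP.preimage ![(.inl k : κ ⊕ ι), .inr i]).fiber y using 1
  ext x
  have : Sum.elim y x ∘ ![(.inl k : κ ⊕ ι), .inr i] = ![y k, x i] := by
    funext j
    fin_cases j <;> rfl
  simp [this]

theorem Indiscernible.mono {r : ℕ} {c : ℕ → Fin r → M} (h : 𝔐.Indiscernible B c) (hAB : A ⊆ B) :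
    𝔐.Indiscernible A c :=
  fun k φ i hi => h k ⟨φ.arity, φ.formula, fun j => ⟨φ.param j, hAB (φ.param j).2⟩⟩ i hi

/-- The sequence `d` is a Morley sequence of the limit type of `c`, taken over a set containing `c`.
To an earlier `d i`, the term `d j` looks like a late term of `c`, and to that term `d i` looks like
a still later one; hence the order is reversed. -/
theorem exists_indiscernible_reversed (hsat : 𝔐.Aleph1Saturated) (hA : A.Countable)
    {P Q : Set (Fin 2 → M)} (hP : 𝔐.FinDefinable A P) (hQ : 𝔐.FinDefinable A Q)
    {c : ℕ → Fin 2 → M} (hcP : ∀ i j, i < j → ![c j 0, c i 1] ∈ P)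
    (hcQ : ∀ i j, i < j → ![c i 0, c j 1] ∈ Q) :
    ∃ d : ℕ → Fin 2 → M, 𝔐.Indiscernible A d ∧ (∀ i j, i < j → ![d i 0, d j 1] ∈ P) ∧
      ∀ i j, i < j → ![d j 0, d i 1] ∈ Q := by
  let B : Set M := A ∪ Set.range fun p : ℕ × Fin 2 => c p.1 p.2
  have hcB (i : ℕ) : A ∪ Set.range (c i) ⊆ B := by
    refine Set.union_subset_union_right _ ?_
    rintro _ ⟨j, rfl⟩
    exact ⟨(i, j), rfl⟩
  let 𝒱 : Ultrafilter (Fin 2 → M) := (Filter.hyperfilter ℕ).map c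
  have h𝒱 {D : Set (Fin 2 → M)} {k : ℕ} (h : ∀ i, k < i → c i ∈ D) : D ∈ 𝒱 := by
    rw [Ultrafilter.mem_map]
    exact Nat.hyperfilter_le_atTop ((Filter.eventually_gt_atTop k).mono h)
  have hB : {x : Fin 2 → M | ∀ j, x j ∈ B} ∈ 𝒱 :=
    h𝒱 (k := 0) fun i _ j => Or.inr ⟨(i, j), rfl⟩
  obtain ⟨d, hd⟩ := hsat.exists_isMorley (hA.union (Set.countable_range _) : B.Countable) 𝒱
  have hdB {i j : ℕ} (hij : i < j) : A ∪ Set.range (d i) ⊆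
      B ∪ Set.range fun p : {i // i < j} × Fin 2 => d p.1 p.2 := by
    refine Set.union_subset_union Set.subset_union_left ?_
    rintro _ ⟨k, rfl⟩
    exact ⟨(⟨i, hij⟩, k), rfl⟩
  have h₁ (i j : ℕ) : ![d i 0, c j 1] ∈ P :=
    hd i _ ((hP.pair_left (c j) 1 0).mono ((hcB j).trans Set.subset_union_left))
      (h𝒱 fun i hi => hcP j i hi)
  have h₂ (i j : ℕ) : ![c i 0, d j 1] ∈ Q :=
    hd j _ ((hQ.pair_right (c i) 0 1).mono ((hcB i).trans Set.subset_union_left))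
      (h𝒱 fun j hj => hcQ i j hj)
  refine ⟨d, (hd.indiscernible hB).mono Set.subset_union_left, fun i j hij => ?_,
    fun i j hij => ?_⟩
  · exact hd j _ ((hP.pair_right (d i) 0 1).mono (hdB hij)) (h𝒱 (k := 0) fun j _ => h₁ i j)
  · exact hd j _ ((hQ.pair_left (d i) 1 0).mono (hdB hij)) (h𝒱 (k := 0) fun j _ => h₂ j i)

theorem Stable.not_indiscernible {S : Set (Fin 2 → M)} (hS : 𝔐.Stable (m := 1) A S)
    {d : ℕ → Fin 2 → M} (hd : 𝔐.Indiscernible A d) (h₁ : ∀ i j, i < j → ![d i 0, d j 1] ∈ S)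
    (h₂ : ∀ i j, i < j → ![d j 0, d i 1] ∈ Sᶜ) : False := by
  obtain ⟨i, j, hij, h⟩ := hS (fun i _ => d i 0) (fun i _ => d i 1)
    (by simpa only [append_eq_pair, pair_eta] using hd)
    (by simpa only [append_eq_pair] using h₁)
  rw [append_eq_pair] at h
  exact h₂ i j hij h

end AMLStructure

namespace MeasuredStructure

open AMLStructure

variable {𝔐 : MeasuredStructure L M} {A : Set M} {𝒰 : Ultrafilter (Fin 1 → M)} {b : Fin 1 → M}

theorem ν_pair_eq {E : Set (Fin 2 → M)} (hE : 𝔐.FinDefinable A E) {y z : Fin 1 → M}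
    (h : 𝔐.SameType A y z) :
    𝔐.ν 1 {x | ![x 0, y 0] ∈ E} = 𝔐.ν 1 {x | ![x 0, z 0] ∈ E} := by
  have key (y x : Fin 1 → M) :
      Sum.elim y x ∘ ![(.inr 0 : Fin 1 ⊕ Fin 1), .inl 0] = ![x 0, y 0] := by
    funext j
    fin_cases j <;> rfl
  have := ν_fiber_eq (k := 0) (hE.preimage ![(.inr 0 : Fin 1 ⊕ Fin 1), .inl 0]) h
  simpa only [Set.mem_ofPred_eq, key] using this

/-- In an infinite Morley sequence some `k` of the fibres meet in positive measure. All Morley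
sequences of length `k` have the same type over `A`, and the measure of the intersection depends
only on that type. -/
theorem ν_iInter_pos (hsat : 𝔐.Aleph1Saturated) (hfin : 𝔐.ν 1 Set.univ < ∞) (hA : A.Countable)
    (h𝒰 : {x : Fin 1 → M | ∀ j, x j ∈ A} ∈ 𝒰) (hb : ∀ D, 𝔐.FinDefinable A D → b ∈ D → D ∈ 𝒰)
    {E : Set (Fin 2 → M)} (hE : 𝔐.FinDefinable A E) (hpos : 0 < 𝔐.ν 1 {x | ![x 0, b 0] ∈ E})
    {k : ℕ} {c : Fin k → Fin 1 → M} (hc : 𝔐.IsMorley 𝒰 A c) :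
    0 < 𝔐.ν 1 {x | ∀ i, ![x 0, c i 0] ∈ E} := by
  let _ := 𝔐.σ 1
  have : IsFiniteMeasure (𝔐.ν 1) := ⟨hfin⟩
  obtain ⟨d, hd⟩ := hsat.exists_isMorley hA 𝒰
  have hdb (i : ℕ) : 𝔐.SameType A b (d i) :=
    sameType_of_imp fun D hD hbD => hd i D (hD.mono Set.subset_union_left) (hb D hD hbD)
  obtain ⟨f, hf, hfpos⟩ := exists_strictMono_measure_iInter_pos (μ := 𝔐.ν 1)
    (E := fun i => {x | ![x 0, d i 0] ∈ E})
    (fun i => measurableSet_of_finDefinable one_pos (hE.pair_left (d i) 0 0)) hpos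
    (fun i => (ν_pair_eq hE (hdb i)).le) k
  have hD : 𝔐.FinDefinable A {z : (Fin k × Fin 1) ⊕ Fin 1 → M |
      ∀ i, ![z (.inr 0), z (.inl (i, 0))] ∈ E} := by
    have key (z : (Fin k × Fin 1) ⊕ Fin 1 → M) (i : Fin k) :
        z ∘ ![.inr 0, .inl (i, 0)] = ![z (.inr 0), z (.inl (i, 0))] := by
      funext j
      fin_cases j <;> rfl
    convert FinDefinable.iInter fun i : Fin k => hE.preimage
      ![(.inr 0 : (Fin k × Fin 1) ⊕ Fin 1), .inl (i, 0)] using 1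
    ext z
    simp [key]
  have := ν_fiber_eq (k := 0) hD (IsMorley.sameType h𝒰 (hd.comp (f := f) fun _ _ h => hf h) hc)
  refine lt_of_lt_of_eq (lt_of_lt_of_eq hfpos ?_) this
  congr 1
  ext x
  simp

theorem exists_sameType_forall_pair_mem (hsat : 𝔐.Aleph1Saturated) (hfin : 𝔐.ν 1 Set.univ < ∞)
    (hA : A.Countable) (h𝒰 : {x : Fin 1 → M | ∀ j, x j ∈ A} ∈ 𝒰)
    (hb : ∀ D, 𝔐.FinDefinable A D → b ∈ D → D ∈ 𝒰) {a : Fin 1 → M}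
    (hwide : ∀ E, 𝔐.FinDefinable A E → ![a 0, b 0] ∈ E → 0 < 𝔐.ν 1 {x | ![x 0, b 0] ∈ E})
    {P : Set (Fin 2 → M)} (hP : 𝔐.FinDefinable A P) (hab : ![a 0, b 0] ∈ P)
    {k : ℕ} {c : Fin (k + 1) → Fin 1 → M} (hc : 𝔐.IsMorley 𝒰 A c) :
    ∃ x : Fin 1 → M, 𝔐.SameType A a x ∧ ∀ i, ![x 0, c i 0] ∈ P := by
  have hPc : 𝔐.FinDefinable (A ∪ Set.range fun p : Fin (k + 1) × Fin 1 => c p.1 p.2)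
      {x : Fin 1 → M | ∀ i, ![x 0, c i 0] ∈ P} := by
    convert FinDefinable.iInter fun i : Fin (k + 1) =>
      hP.pair_left (fun p : Fin (k + 1) × Fin 1 => c p.1 p.2) (i, 0) (0 : Fin 1) using 1
    ext x
    simp
  have hex : ∃ x, ∀ X ∈ {X | ∃ D, 𝔐.FinDefinable A D ∧ a ∈ D ∧
      X = D ∩ {x | ∀ i, ![x 0, c i 0] ∈ P}}, x ∈ X := by
    refine hsat.exists_forall_mem (hA.union (Set.countable_range
      fun p : Fin (k + 1) × Fin 1 => c p.1 p.2))
      ⟨_, _, FinDefinable.univ, trivial, rfl⟩ ?_ ?_ ?_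
    · rintro _ ⟨D, hD, -, rfl⟩
      exact (hD.mono Set.subset_union_left).inter hPc
    · rintro _ ⟨D, hD, haD, rfl⟩
      -- The pairs in `P` with first coordinate in `D`: this set contains `(a, b)`, so its fibre
      -- over `b` has positive measure.
      have hDP := (hD.preimage ![(0 : Fin 2)]).inter hP
      have key (x : Fin 1 → M) (y : M) : ![x 0, y] ∘ ![(0 : Fin 2)] = x := by
        funext i
        fin_cases i
        rfl
      have hpos := hwide _ hDP ⟨by simpa only [Set.mem_ofPred_eq, key] using haD, hab⟩
      let _ := 𝔐.σ 1
      obtain ⟨x, hx⟩ := nonempty_of_measure_ne_zero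
        (ν_iInter_pos hsat hfin hA h𝒰 hb hDP hpos hc).ne'
      refine ⟨x, ?_, fun i => (hx i).2⟩
      -- The sequence `c` has at least one term, and any term puts `x` in `D`.
      simpa only [Set.mem_ofPred_eq, key] using (hx 0).1
    · rintro _ ⟨D, hD, haD, rfl⟩ _ ⟨E, hE, haE, rfl⟩
      exact ⟨D ∩ E, hD.inter hE, ⟨haD, haE⟩, (Set.inter_inter_distrib_right _ _ _).symm⟩
  obtain ⟨x, hx⟩ := hex
  refine ⟨x, sameType_of_imp fun D hD haD => (hx _ ⟨D, hD, haD, rfl⟩).1, ?_⟩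
  exact (hx _ ⟨_, FinDefinable.univ, trivial, rfl⟩).2

theorem exists_halfGraph (hsat : 𝔐.Aleph1Saturated) (hfin : 𝔐.ν 1 Set.univ < ∞)
    (hA : A.Countable) (h𝒰 : {x : Fin 1 → M | ∀ j, x j ∈ A} ∈ 𝒰)
    (hb : ∀ D, 𝔐.FinDefinable A D → b ∈ D → D ∈ 𝒰) {a : Fin 1 → M}
    (hwide : ∀ E, 𝔐.FinDefinable A E → ![a 0, b 0] ∈ E → 0 < 𝔐.ν 1 {x | ![x 0, b 0] ∈ E})
    {P Q : Set (Fin 2 → M)} (hP : 𝔐.FinDefinable A P) (hQ : 𝔐.FinDefinable A Q)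
    (hab : ![a 0, b 0] ∈ P) (haQ : {y | ![a 0, y 0] ∈ Q} ∈ 𝒰) :
    ∃ c : ℕ → Fin 2 → M, (∀ i j, i ≤ j → ![c j 0, c i 1] ∈ P) ∧
      ∀ i j, i < j → ![c i 0, c j 1] ∈ Q := by
  obtain ⟨c, hc⟩ := exists_seq_of_forall_fin (X := Fin 2 → M)
    -- The second coordinate realizes `𝒰` over all earlier terms. The condition on the first is
    -- imposed only if the second coordinates form a Morley sequence, so that every history can be
    -- continued.
    (fun n h x =>
      (∀ D : Set (Fin 1 → M), 𝔐.FinDefinable (A ∪ Set.range fun p : Fin n × Fin 2 => h p.1 p.2) D →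
        D ∈ 𝒰 → (fun _ => x 1) ∈ D) ∧
      ∀ c : Fin (n + 1) → Fin 1 → M, (∀ i : Fin n, c i.castSucc = fun _ => h i 1) →
        (c (Fin.last n) = fun _ => x 1) → 𝔐.IsMorley 𝒰 A c →
        𝔐.SameType A a (fun _ => x 0) ∧ ∀ i, ![x 0, c i 0] ∈ P) (by
    intro n h
    obtain ⟨y, hy⟩ := hsat.exists_realization
      (hA.union (Set.countable_range fun p : Fin n × Fin 2 => h p.1 p.2)) 𝒰
    have hy0 : (fun _ => y 0) = y := by
      funext i
      fin_cases i
      rfl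
    by_cases hM : 𝔐.IsMorley 𝒰 A (Fin.snoc (fun i _ => h i 1) y : Fin (n + 1) → Fin 1 → M)
    · obtain ⟨x, hx, hxP⟩ := exists_sameType_forall_pair_mem hsat hfin hA h𝒰 hb hwide hP hab hM
      have hx0 : (fun _ => x 0) = x := by
        funext i
        fin_cases i
        rfl
      refine ⟨![x 0, y 0], by simpa [hy0] using hy, fun c hc hcl _ => ?_⟩
      have : c = (Fin.snoc (fun i _ => h i 1) y : Fin (n + 1) → Fin 1 → M) := by
        funext i
        refine Fin.lastCases ?_ (fun i => ?_) i
        · rw [hcl, Fin.snoc_last, ← hy0]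
          rfl
        · rw [hc, Fin.snoc_castSucc]
      subst this
      exact ⟨by simpa [hx0] using hx, hxP⟩
    · refine ⟨![y 0, y 0], by simpa [hy0] using hy, fun c hc hcl hcM => absurd ?_ hM⟩
      convert hcM using 1
      funext i
      refine Fin.lastCases ?_ (fun i => ?_) i
      · rw [hcl, Fin.snoc_last, ← hy0]
        rfl
      · rw [hc, Fin.snoc_castSucc])
  have hM : 𝔐.IsMorley 𝒰 A (fun i (_ : Fin 1) => c i 1) := by
    refine isMorley_of_forall_fin fun n D hD => (hc n).1 D (hD.mono
      (Set.union_subset_union_right _ ?_))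
    rintro _ ⟨p, rfl⟩
    exact ⟨(p.1, 1), rfl⟩
  have h (n : ℕ) := (hc n).2 (fun i _ => c i 1) (fun i => rfl) rfl
    (hM.comp (f := fun i : Fin (n + 1) => (i : ℕ)) fun _ _ h => h)
  refine ⟨c, fun i j hij => (h j).2 ⟨i, Nat.lt_succ_of_le hij⟩, fun i j hij => ?_⟩
  refine (hc j).1 {y | ![c i 0, y 0] ∈ Q} ((hQ.pair_right (fun _ : Fin 1 => c i 0) 0 0).mono
    (Set.union_subset_union_right _ ?_)) ?_
  · rintro _ ⟨-, rfl⟩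
    exact ⟨(⟨i, hij⟩, 0), rfl⟩
  · have key (z y : Fin 1 → M) :
        Sum.elim z y ∘ ![(.inl 0 : Fin 1 ⊕ Fin 1), .inr 0] = ![z 0, y 0] := by
      funext j
      fin_cases j <;> rfl
    have := fiber_mem_iff_of_sameType h𝒰 (hQ.preimage ![(.inl 0 : Fin 1 ⊕ Fin 1), .inr 0]) (h i).1
    simp only [Set.mem_ofPred_eq, key] at this
    exact this.1 haQ

theorem Wide.ν_pos {a : Fin 1 → M} (h : 𝔐.Wide (𝔐.tp a (A ∪ Set.range b))) {E : Set (Fin 2 → M)}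
    (hE : 𝔐.FinDefinable A E) (hab : ![a 0, b 0] ∈ E) : 0 < 𝔐.ν 1 {x | ![x 0, b 0] ∈ E} := by
  obtain ⟨φ, hφ⟩ := definableOver_iff.2 (hE.pair_left b 0 (0 : Fin 1))
  rw [hφ]
  refine h φ ?_
  change a ∈ 𝔐.defSet φ
  rwa [← hφ]

theorem wideStable_of_stable (hsat : 𝔐.Aleph1Saturated) (hfin : 𝔐.ν 1 Set.univ < ∞)
    {N : L.Substructure M} {𝔑 : AMLStructure L N} (hN : 𝔐.IsElementarySubstructure 𝔑)
    (hNc : (N : Set M).Countable) {S : Set (Fin 2 → M)} (hS : 𝔐.FinDefinable (N : Set M) S)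
    (hst : 𝔐.Stable (m := 1) (N : Set M) S) : 𝔐.WideStable (m := 1) (N : Set M) S := by
  refine ⟨fun c c' h => tp_eq_iff.1 h S hS, fun a a' b b' ha hb hw hw' hab => ?_⟩
  rw [tp_eq_iff] at ha hb
  rw [append_eq_pair] at hab ⊢
  by_contra hab'
  obtain ⟨𝒰, h𝒰, hb𝒰⟩ := hN.exists_coheir b
  by_cases haS : {y | ![a 0, y 0] ∈ S} ∈ 𝒰
  · have key (z y : Fin 1 → M) :
        Sum.elim z y ∘ ![(.inl 0 : Fin 1 ⊕ Fin 1), .inr 0] = ![z 0, y 0] := by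
      funext j
      fin_cases j <;> rfl
    have haS' := fiber_mem_iff_of_sameType h𝒰
      (hS.preimage ![(.inl 0 : Fin 1 ⊕ Fin 1), .inr 0]) ha
    simp only [Set.mem_ofPred_eq, key] at haS'
    obtain ⟨c, hc₁, hc₂⟩ := exists_halfGraph hsat hfin hNc h𝒰
      (fun D hD h => hb𝒰 D hD ((hb D hD).2 h)) (fun E => hw'.ν_pos) hS.compl hS hab' (haS'.1 haS)
    -- The half graph already has the order that stability forbids but need not be indiscernible;
    -- two reversals make it so and keep the order.
    obtain ⟨d, -, hd₁, hd₂⟩ := exists_indiscernible_reversed hsat hNc hS.compl hS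
      (fun i j hij => hc₁ i j hij.le) hc₂
    obtain ⟨e, he, he₁, he₂⟩ := exists_indiscernible_reversed hsat hNc hS hS.compl hd₂ hd₁
    exact hst.not_indiscernible he he₁ he₂
  · obtain ⟨c, hc₁, hc₂⟩ := exists_halfGraph hsat hfin hNc h𝒰 hb𝒰 (fun E => hw.ν_pos) hS hS.compl
      hab (Ultrafilter.compl_mem_iff_notMem.2 haS)
    obtain ⟨d, hd, hd₁, hd₂⟩ := exists_indiscernible_reversed hsat hNc hS hS.compl
      (fun i j hij => hc₁ i j hij.le) hc₂
    exact hst.not_indiscernible hd hd₁ hd₂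

end MeasuredStructure

end Stability

/-! ### Approximation by sets that depend on the types of the coordinates -/

section Approximation

variable {L : FirstOrder.Language.{u, v}} {M : Type w} [L.Structure M]

namespace AMLStructure

variable {𝔐 : AMLStructure L M} {A : Set M}

/-- A definable set of pairs to which membership is determined by the types of the two
coordinates. -/
def RespectsTypes (𝔐 : AMLStructure L M) (A : Set M) (S : Set (Fin 2 → M)) : Prop :=
  𝔐.FinDefinable A S ∧ ∀ x x' : Fin 2 → M,
    (∀ j, 𝔐.SameType A (fun _ : Fin 1 => x j) fun _ => x' j) → x ∈ S → x' ∈ S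

/-- This ring contains the generators of `𝓑_{2,1}(A)`, so its members approximate all sets of that
σ-algebra in measure. -/
theorem isSetRing_respectsTypes : IsSetRing {S | 𝔐.RespectsTypes A S} where
  empty_mem := ⟨by simpa using (FinDefinable.univ (𝔐 := 𝔐) (A := A) (ι := Fin 2)).compl,
    fun _ _ _ h => h⟩
  union_mem S T hS hT := ⟨hS.1.union hT.1, fun x x' h => Or.imp (hS.2 x x' h) (hT.2 x x' h)⟩
  sdiff_mem S T hS hT := ⟨hS.1.inter hT.1.compl, fun x x' h hx =>
    ⟨hS.2 x x' h hx.1, fun h' => hx.2 (hT.2 x' x (fun j => (h j).symm) h')⟩⟩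

theorem respectsTypes_coordinate {Φ : Set (Fin 1 → M)} (hΦ : 𝔐.FinDefinable A Φ) (j : Fin 2) :
    𝔐.RespectsTypes A {x | (fun _ => x j) ∈ Φ} :=
  ⟨hΦ.preimage fun _ => j, fun _ _ h hx => (h j Φ hΦ).1 hx⟩

theorem Indiscernible.sameType {r : ℕ} {c : ℕ → Fin r → M} (h : 𝔐.Indiscernible A c) :
    𝔐.SameType A (c 0) (c 1) := by
  intro D hD
  obtain ⟨φ, hφ⟩ := definableOver_iff.2
    (hD.preimage fun j => (finProdFinEquiv ((0 : Fin 1), j) : Fin (1 * r)))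
  have := h 1 φ (fun _ => 1) (Subsingleton.strictMono _)
  rw [← hφ] at this
  have key (t : Fin 1 → Fin r → M) :
      (flatten t ∘ fun j => (finProdFinEquiv ((0 : Fin 1), j) : Fin (1 * r))) = t 0 := by
    funext j
    simp [flatten]
  simp only [Set.mem_ofPred_eq, key] at this
  exact this

theorem RespectsTypes.stable {S : Set (Fin 2 → M)} (hS : 𝔐.RespectsTypes A S) :
    𝔐.Stable (m := 1) A S := by
  intro a b hab h
  refine ⟨0, 1, one_pos, hS.2 _ _ (fun j => ?_) (h 0 1 one_pos)⟩
  have := hab.sameType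
  simp only [append_eq_pair] at this ⊢
  fin_cases j
  · exact this.comp fun _ => 0
  · exact this.symm.comp fun _ => 1

theorem measurableSet_coordinate {Φ : Set (Fin 1 → M)} (hΦ : 𝔐.FinDefinable A Φ) (j : Fin 2) :
    MeasurableSet[𝔐.sigmaAlgSub 2 1 A] {x | (fun _ => x j) ∈ Φ} := by
  obtain ⟨φ, rfl⟩ := definableOver_iff.2 hΦ
  refine MeasurableSpace.measurableSet_generateFrom ⟨{j}, Finset.card_singleton j, φ, ?_⟩
  simp

theorem exists_seq_finDefinable [Countable L.Symbols] (hA : A.Countable) (n : ℕ) :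
    ∃ e : ℕ → Set (Fin n → M), (∀ i, 𝔐.FinDefinable A (e i)) ∧
      ∀ D, 𝔐.FinDefinable A D → ∃ i, e i = D := by
  have := countable_paramFormula (L := L) hA n
  have hc : {D : Set (Fin n → M) | 𝔐.FinDefinable A D}.Countable := by
    refine (Set.countable_range (𝔐.defSet (A := A) (n := n))).mono fun D hD => ?_
    obtain ⟨φ, rfl⟩ := definableOver_iff.2 hD
    exact ⟨φ, rfl⟩
  obtain ⟨e, he⟩ := hc.exists_eq_range ⟨_, FinDefinable.univ⟩
  exact ⟨e, fun i => he.ge ⟨i, rfl⟩, fun D hD => he.le hD⟩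

/-- On `⋂ i, K i` the types of the coordinates decide membership in `S`. By saturation finitely many
`K i` and finitely many unary definable sets suffice for this. -/
theorem exists_types_separated [Countable L.Symbols] (hsat : 𝔐.Aleph1Saturated)
    (hA : A.Countable) {S : Set (Fin 2 → M)} (hS : 𝔐.FinDefinable A S) {K : ℕ → Set (Fin 2 → M)}
    (hK : ∀ i, 𝔐.FinDefinable A (K i))
    (h : ∀ x x' : Fin 2 → M, (∀ i, x ∈ K i) → (∀ i, x' ∈ K i) →
      (∀ j, 𝔐.SameType A (fun _ : Fin 1 => x j) fun _ => x' j) → x ∈ S → x' ∈ S) :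
    ∃ U, MeasurableSet[𝔐.sigmaAlgSub 2 1 A] U ∧ symmDiff S U ⊆ ⋃ i, (K i)ᶜ := by
  obtain ⟨Φ, hΦ, hΦ'⟩ := exists_seq_finDefinable (𝔐 := 𝔐) hA 1
  -- A point of `M ^ 4` is read as two pairs; a point in all `C n` would be a counterexample to `h`.
  let G (i : ℕ) : Set (Fin 4 → M) := {z | z ∘ ![0, 1] ∈ K i} ∩ {z | z ∘ ![2, 3] ∈ K i} ∩
    ⋂ j : Fin 2, {z | z ∈ {z : Fin 4 → M | z ∘ (fun _ => ![0, 1] j) ∈ Φ i} ↔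
      z ∈ {z : Fin 4 → M | z ∘ (fun _ => ![2, 3] j) ∈ Φ i}}
  let C (n : ℕ) : Set (Fin 4 → M) :=
    {z | z ∘ ![0, 1] ∈ S} ∩ {z | z ∘ ![2, 3] ∈ Sᶜ} ∩ ⋂ i ∈ Set.Iio n, G i
  have hC (n : ℕ) : 𝔐.FinDefinable A (C n) :=
    ((hS.preimage _).inter (hS.compl.preimage _)).inter (FinDefinable.biInter (Set.finite_Iio n)
      fun i _ => (((hK i).preimage _).inter ((hK i).preimage _)).inter
        (FinDefinable.iInter fun j => ((hΦ i).preimage _).iff ((hΦ i).preimage _)))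
  have hanti : Antitone C := fun n n' hn => Set.inter_subset_inter_right _
    (Set.biInter_subset_biInter_left (Set.Iio_subset_Iio hn))
  obtain ⟨n, hn⟩ : ∃ n, ¬ (C n).Nonempty := by
    by_contra! hne
    obtain ⟨z, hz⟩ := hsat.exists_forall_mem hA (𝒟 := Set.range C) (Set.range_nonempty C)
      (by rintro _ ⟨n, rfl⟩; exact hC n) (by rintro _ ⟨n, rfl⟩; exact hne n) (by
        rintro _ ⟨n, rfl⟩ _ ⟨n', rfl⟩
        rcases le_total n n' with hn | hn
        · exact ⟨n', (Set.inter_eq_right.2 (hanti hn)).symm⟩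
        · exact ⟨n, (Set.inter_eq_left.2 (hanti hn)).symm⟩)
    have hG (i : ℕ) : z ∈ G i :=
      Set.mem_iInter₂.1 (hz _ ⟨i + 1, rfl⟩).2 i (Set.mem_Iio.2 i.lt_succ_self)
    refine (hz _ ⟨0, rfl⟩).1.2 (h _ _ (fun i => (hG i).1.1) (fun i => (hG i).1.2)
      (fun j D hD => ?_) (hz _ ⟨0, rfl⟩).1.1)
    obtain ⟨i, rfl⟩ := hΦ' D hD
    exact Set.mem_iInter.1 (hG i).2 j
  let g (w : Fin 2 → M) (i : Fin n) : Prop × Prop := ((fun _ => w 0) ∈ Φ i, (fun _ => w 1) ∈ Φ i)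
  have hg : Measurable[𝔐.sigmaAlgSub 2 1 A] g := by
    let _ := 𝔐.sigmaAlgSub 2 1 A
    exact measurable_pi_iff.2 fun i => (measurableSet_setOfPred.1
      (measurableSet_coordinate (hΦ i) 0)).prodMk
        (measurableSet_setOfPred.1 (measurableSet_coordinate (hΦ i) 1))
  have hsep (v w : Fin 2 → M) (hvK : ∀ i < n, v ∈ K i) (hwK : ∀ i < n, w ∈ K i) (hgv : g v = g w)
      (hvS : v ∈ S) : w ∈ S := by
    by_contra hwS
    have hv : ![v 0, v 1, w 0, w 1] ∘ ![(0 : Fin 4), 1] = v := by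
      funext j
      fin_cases j <;> rfl
    have hw : ![v 0, v 1, w 0, w 1] ∘ ![(2 : Fin 4), 3] = w := by
      funext j
      fin_cases j <;> rfl
    refine hn ⟨![v 0, v 1, w 0, w 1], ⟨?_, ?_⟩, Set.mem_iInter₂.2 fun i hi => ⟨⟨?_, ?_⟩,
      Set.mem_iInter.2 fun j => ?_⟩⟩
    · rwa [Set.mem_ofPred_eq, hv]
    · rwa [Set.mem_ofPred_eq, hw]
    · rw [Set.mem_ofPred_eq, hv]
      exact hvK i hi
    · rw [Set.mem_ofPred_eq, hw]
      exact hwK i hi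
    · have := congrFun hgv ⟨i, hi⟩
      fin_cases j
      · exact (Prod.ext_iff.1 this).1.to_iff
      · exact (Prod.ext_iff.1 this).2.to_iff
  -- `g` takes finitely many values, so the union of the classes that meet `S` inside the first `n`
  -- sets `K i` is measurable.
  refine ⟨g ⁻¹' (g '' (S ∩ ⋂ i ∈ Set.Iio n, K i)), hg (Set.toFinite _).measurableSet, ?_⟩
  intro w hw
  by_contra hwK
  simp only [Set.mem_iUnion, Set.mem_compl_iff, not_exists, not_not] at hwK
  rcases hw with ⟨hwS, hwU⟩ | ⟨⟨v, hv, hvw⟩, hwS⟩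
  · exact hwU ⟨w, ⟨hwS, Set.mem_iInter₂.2 fun i _ => hwK i⟩, rfl⟩
  · exact hwS (hsep v w (fun i hi => Set.mem_iInter₂.1 hv.2 i hi) (fun i _ => hwK i) hvw hv.1)

end AMLStructure

namespace MeasuredStructure

open AMLStructure

variable {𝔐 : MeasuredStructure L M} {A : Set M}

theorem ν_two_univ_lt_top (hfin : 𝔐.ν 1 Set.univ < ∞) : 𝔐.ν 2 Set.univ < ∞ := by
  have h := 𝔐.ν_prod 1 1 one_pos one_pos Set.univ Set.univ (@MeasurableSet.univ _ (𝔐.σ 1))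
    (@MeasurableSet.univ _ (𝔐.σ 1))
  have : prodSet (Set.univ : Set (Fin 1 → M)) (Set.univ : Set (Fin 1 → M)) = Set.univ := by
    ext
    simp [prodSet]
  rw [this] at h
  exact h.trans_lt (ENNReal.mul_lt_top hfin hfin)

theorem exists_respectsTypes_symmDiff_lt (hfin : 𝔐.ν 1 Set.univ < ∞) {U : Set (Fin 2 → M)}
    (hU : MeasurableSet[𝔐.sigmaAlgSub 2 1 A] U) {ε : ℝ≥0∞} (hε : 0 < ε) :
    ∃ S, 𝔐.RespectsTypes A S ∧ 𝔐.ν 2 (symmDiff U S) < ε := by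
  have hle : MeasurableSpace.generateFrom {S | 𝔐.RespectsTypes A S} ≤ 𝔐.σ 2 :=
    MeasurableSpace.generateFrom_le fun S hS => measurableSet_of_finDefinable two_pos hS.1
  have hle' : 𝔐.sigmaAlgSub 2 1 A ≤ MeasurableSpace.generateFrom {S | 𝔐.RespectsTypes A S} := by
    refine MeasurableSpace.generateFrom_le ?_
    rintro _ ⟨I, hI, φ, rfl⟩
    obtain ⟨j, rfl⟩ := Finset.card_eq_one.1 hI
    refine MeasurableSpace.measurableSet_generateFrom ?_
    simpa using respectsTypes_coordinate (definableOver_iff.1 ⟨φ, rfl⟩) j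
  have : IsFiniteMeasure ((𝔐.ν 2).trim hle) := by
    refine ⟨?_⟩
    rw [trim_measurableSet_eq hle (@MeasurableSet.univ _ (_))]
    exact ν_two_univ_lt_top hfin
  obtain ⟨S, hS, h⟩ := exists_measure_symmDiff_lt_of_generateFrom_isSetRing
    (mα := MeasurableSpace.generateFrom {S | 𝔐.RespectsTypes A S}) (μ := (𝔐.ν 2).trim hle)
    isSetRing_respectsTypes ⟨{Set.univ}, Set.countable_singleton _, by
      rintro _ rfl
      exact ⟨FinDefinable.univ, fun _ _ _ h => h⟩, by simp⟩ rfl (hle' U hU) hε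
  refine ⟨S, hS, ?_⟩
  rw [symmDiff_comm]
  exact (le_trim hle).trans_lt h

/-- The points of `D` on sections of measure at most about `1/(n+1)` form decreasing definable sets
`Z n` with null intersection, by Fubini; `K` is the complement of a late one. -/
theorem exists_definable_wide (hfin : 𝔐.ν 1 Set.univ < ∞) {D : Set (Fin 2 → M)}
    (hD : 𝔐.FinDefinable A D) {ε : ℝ≥0∞} (hε : 0 < ε) :
    ∃ K, 𝔐.FinDefinable A K ∧ 𝔐.ν 2 Kᶜ < ε ∧
      ∀ x ∈ K, x ∈ D → 0 < 𝔐.ν 1 {z | ![z 0, x 1] ∈ D} := by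
  let q (n : ℕ) : ℚ≥0 := ((n : ℚ≥0) + 1)⁻¹
  have hq (n : ℕ) : ratCast (q n) = ((n : ℝ≥0∞) + 1)⁻¹ := by
    change (((q n : ℚ≥0) : ℝ≥0) : ℝ≥0∞) = _
    simp [q]
  have hsec (x : Fin 2 → M) : 𝔐.FinDefinable (A ∪ Set.range x) {z : Fin 1 → M | ![z 0, x 1] ∈ D} :=
    hD.pair_left x 1 0
  let Z (n : ℕ) : Set (Fin 2 → M) :=
    D ∩ {x | 𝔐.MeasHolds Cmp.le (q n) 1 {z | ![z 0, x 1] ∈ D}}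
  have hZ (n : ℕ) : 𝔐.FinDefinable A (Z n) := by
    refine hD.inter ?_
    have key (x : Fin 2 → M) (z : Fin 1 → M) :
        Fin.append x z ∘ ![(2 : Fin 3), 1] = ![z 0, x 1] := by
      funext j
      fin_cases j <;> rfl
    have := (hD.preimage ![(2 : Fin 3), 1]).measHolds (n := 2) (k := 0) Cmp.le (q n)
    simpa only [Set.mem_ofPred_eq, key] using this
  have hanti : Antitone Z := by
    refine antitone_nat_of_succ_le fun n x hx => ⟨hx.1, ?_⟩
    -- A measure at most `q (n + 1)` is strictly below `q n`, so the label at equality is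
    -- irrelevant.
    refine measHolds_of_lt one_pos (hsec x)
      ((ν_le_of_measHolds one_pos (hsec x) hx.2).trans_lt ?_)
    rw [hq, hq, ENNReal.inv_lt_inv]
    push_cast
    exact ENNReal.lt_add_right (by simp) one_ne_zero
  have hmeas (n : ℕ) : MeasurableSet[𝔐.σ 2] (Z n) := measurableSet_of_finDefinable two_pos (hZ n)
  have hnull : 𝔐.ν 2 (⋂ n, Z n) = 0 := by
    have h := 𝔐.fubini_right 1 1 one_pos one_pos (⋂ n, Z n)
      (@MeasurableSet.iInter _ _ (𝔐.σ 2) _ _ hmeas)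
    refine h.trans ?_
    have hz (y : Fin 1 → M) : 𝔐.ν 1 {x | Fin.append x y ∈ ⋂ n, Z n} = 0 := by
      rcases Set.eq_empty_or_nonempty {x | Fin.append x y ∈ ⋂ n, Z n} with he | ⟨x₀, hx₀⟩
      · rw [he]
        exact measure_empty
      · have hle : 𝔐.ν 1 {z | ![z 0, y 0] ∈ D} = 0 := by
          refine le_antisymm (ge_of_tendsto' (b := 𝔐.ν 1 {z | ![z 0, y 0] ∈ D})
            ((Filter.tendsto_add_atTop_iff_nat 1).2 ENNReal.tendsto_inv_nat_nhds_zero)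
            fun n => ?_) bot_le
          have := ν_le_of_measHolds one_pos (hsec _) (Set.mem_iInter.1 hx₀ n).2
          rw [hq] at this
          rw [append_eq_pair] at this
          exact_mod_cast this
        refine measure_mono_null (fun x hx => ?_) hle
        have := (Set.mem_iInter.1 hx 0).1
        rwa [append_eq_pair] at this
    simp only [hz, lintegral_zero]
  have htend := tendsto_measure_iInter_atTop (μ := 𝔐.ν 2)
    (fun n => (hmeas n).nullMeasurableSet) hanti
    ⟨0, ((measure_mono (Set.subset_univ _)).trans_lt (ν_two_univ_lt_top hfin)).ne⟩
  rw [hnull] at htend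
  obtain ⟨n, hn⟩ := (htend.eventually (gt_mem_nhds hε)).exists
  refine ⟨(Z n)ᶜ, (hZ n).compl, by rwa [compl_compl], fun x hx hxD => ?_⟩
  by_contra h0
  refine hx ⟨hxD, measHolds_of_lt one_pos (hsec x) ?_⟩
  rw [nonpos_iff_eq_zero.1 (not_lt.1 h0), hq]
  simp

/-- A formula over `A` and `b` is a fibre of an `A`-definable set of pairs, so wideness for every
`b` is tested by one countable family when `A` and the signature are countable. -/
theorem wide_tp_of_forall {a b : Fin 1 → M}
    (h : ∀ D, 𝔐.FinDefinable A D → ![a 0, b 0] ∈ D → 0 < 𝔐.ν 1 {z | ![z 0, b 0] ∈ D}) :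
    𝔐.Wide (𝔐.tp a (A ∪ Set.range b)) := by
  intro φ hφ
  obtain ⟨E, hE, hEφ⟩ := (definableOver_iff.1 ⟨φ, rfl⟩ : 𝔐.FinDefinable _ (𝔐.defSet φ)).exists_fiber
  have key (z : Fin 1 → M) :
      ![z 0, b 0] ∘ Sum.elim (fun _ : Fin 1 => (1 : Fin 2)) (fun _ : Fin 1 => 0) =
        Sum.elim b z := by
    funext j
    rcases j with j | j <;> fin_cases j <;> rfl
  have := h _ (hE.preimage (Sum.elim (fun _ => 1) fun _ => 0))
  simp only [Set.mem_ofPred_eq, key] at this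
  rw [hEφ]
  refine this ?_
  have ha : a ∈ 𝔐.defSet φ := hφ
  rwa [hEφ] at ha

theorem WideStable.exists_symmDiff_lt [Countable L.Symbols] (hsat : 𝔐.Aleph1Saturated)
    (hfin : 𝔐.ν 1 Set.univ < ∞) (hA : A.Countable) {S : Set (Fin 2 → M)}
    (hS : 𝔐.FinDefinable A S) (hw : 𝔐.WideStable (m := 1) A S) {ε : ℝ≥0∞} (hε : 0 < ε) :
    ∃ U, MeasurableSet[𝔐.sigmaAlgSub 2 1 A] U ∧ 𝔐.ν 2 (symmDiff S U) < ε := by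
  obtain ⟨E, hE, hE'⟩ := exists_seq_finDefinable (𝔐 := 𝔐.toAMLStructure) hA 2
  obtain ⟨δ, hδ, hδε⟩ := ENNReal.exists_pos_sum_of_countable' hε.ne' ℕ
  choose K hK hKδ hKwide using fun i => exists_definable_wide hfin (hE i) (hδ i)
  have hwide (x : Fin 2 → M) (hx : ∀ i, x ∈ K i) :
      𝔐.Wide (𝔐.tp (fun _ : Fin 1 => x 0) (A ∪ Set.range fun _ : Fin 1 => x 1)) := by
    refine wide_tp_of_forall fun D hD hxD => ?_
    obtain ⟨i, rfl⟩ := hE' D hD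
    rw [pair_eta] at hxD
    exact hKwide i x (hx i) hxD
  obtain ⟨U, hU, hSU⟩ := exists_types_separated hsat hA hS hK (by
    intro x x' hx hx' h hxS
    have := hw.2 (fun _ => x 0) (fun _ => x' 0) (fun _ => x 1) (fun _ => x' 1)
      (tp_eq_iff.2 (h 0)) (tp_eq_iff.2 (h 1)) (hwide x hx) (hwide x' hx')
    simp only [append_eq_pair, pair_eta] at this
    exact this hxS)
  refine ⟨U, hU, (measure_mono hSU).trans_lt ((measure_iUnion_le _).trans_lt ?_)⟩
  exact (ENNReal.tsum_le_tsum fun i => (hKδ i).le).trans_lt hδε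

theorem exists_sigmaAlgSub_of_adws [Countable L.Symbols] (hsat : 𝔐.Aleph1Saturated)
    (hfin : 𝔐.ν 1 Set.univ < ∞) (hA : A.Countable) {R : Set (Fin 2 → M)} (h : 𝔐.ADWS A R) :
    ∃ U, MeasurableSet[𝔐.sigmaAlgSub 2 1 A] U ∧ 𝔐.ν 2 (symmDiff R U) = 0 := by
  obtain ⟨δ, hδ, hδ'⟩ := ENNReal.exists_pos_sum_of_countable one_ne_zero ℕ
  have hU (k : ℕ) : ∃ U, MeasurableSet[𝔐.sigmaAlgSub 2 1 A] U ∧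
      𝔐.ν 2 (symmDiff R U) ≤ 2 * δ k := by
    obtain ⟨S, hS, hSdef, hRS⟩ := h (δ k) (hδ k)
    rw [ENNReal.ofReal_coe_nnreal] at hRS
    obtain ⟨U, hU, hSU⟩ := hS.exists_symmDiff_lt hsat hfin hA (definableOver_iff.1 hSdef)
      (ENNReal.coe_pos.2 (hδ k))
    refine ⟨U, hU, (measure_symmDiff_le R S U).trans ?_⟩
    rw [two_mul]
    exact add_le_add hRS.le hSU.le
  choose U hU hRU using hU
  -- The errors are summable, so by Borel–Cantelli almost every point is eventually in `U k` exactly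
  -- when it is in `R`; the liminf of the `U k` therefore agrees with `R` almost everywhere.
  refine ⟨⋃ n, ⋂ k ≥ n, U k, MeasurableSet.iUnion fun n => MeasurableSet.iInter fun k =>
    MeasurableSet.iInter fun _ => hU k, ?_⟩
  let _ := 𝔐.σ 2
  have hsum : ∑' k, 𝔐.ν 2 (symmDiff R (U k)) ≠ ∞ := by
    refine ((ENNReal.tsum_le_tsum hRU).trans_lt ?_).ne
    rw [ENNReal.tsum_mul_left]
    exact ENNReal.mul_lt_top (by simp) (hδ'.trans ENNReal.one_lt_top)
  refine measure_symmDiff_eq_zero_iff.2 (Filter.eventuallyEq_set.2 ?_)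
  filter_upwards [ae_eventually_notMem hsum] with x hx
  obtain ⟨n, hn⟩ := Filter.eventually_atTop.1 hx
  have hiff (k : ℕ) (hk : n ≤ k) : x ∈ R ↔ x ∈ U k := by
    have := hn k hk
    rw [Set.mem_symmDiff] at this
    tauto
  simp only [Set.mem_iUnion, Set.mem_iInter]
  constructor
  · exact fun hxR => ⟨n, fun k hk => (hiff k hk).1 hxR⟩
  · rintro ⟨m, hm⟩
    exact (hiff _ (le_max_right m n)).2 (hm _ (le_max_left m n))

end MeasuredStructure

end Approximation

end AML

theorem mainTheorem9 {L : FirstOrder.Language.{u, v}} [Countable L.Symbols]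
    {M : Type w} [L.Structure M] (𝔐 : AML.MeasuredStructure L M)
    (hsat : 𝔐.Aleph1Saturated) (hfin : 𝔐.ν 1 Set.univ < ∞)
    (N : L.Substructure M) (𝔑 : AML.AMLStructure L N)
    (hN : 𝔐.IsElementarySubstructure 𝔑) (hNc : (N : Set M).Countable)
    (R : Set (Fin 2 → M)) (hR : MeasurableSet[𝔐.sigmaAlg 2 (N : Set M)] R) :
    List.TFAE [
      ∃ U : Set (Fin 2 → M), MeasurableSet[𝔐.sigmaAlgSub 2 1 (N : Set M)] U ∧
        𝔐.ν 2 (symmDiff R U) = 0,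
      𝔐.ADS (N : Set M) R,
      𝔐.ADWS (N : Set M) R] := by
  tfae_have 1 → 2 := by
    rintro ⟨U, hU, hRU⟩ ε hε
    obtain ⟨S, hS, hUS⟩ := AML.MeasuredStructure.exists_respectsTypes_symmDiff_lt hfin hU
      (ENNReal.ofReal_pos.2 hε)
    refine ⟨S, hS.stable, AML.AMLStructure.definableOver_iff.2 hS.1, ?_⟩
    refine (measure_symmDiff_le R U S).trans_lt ?_
    rwa [hRU, zero_add]
  tfae_have 2 → 3 := by
    intro h ε hε
    obtain ⟨S, hS, hSdef, hRS⟩ := h ε hε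
    exact ⟨S, AML.MeasuredStructure.wideStable_of_stable hsat hfin hN hNc
      (AML.AMLStructure.definableOver_iff.1 hSdef) hS, hSdef, hRS⟩
  tfae_have 3 → 1 := AML.MeasuredStructure.exists_sigmaAlgSub_of_adws hsat hfin hNc
  tfae_finish
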